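/- Let $N\ge 3$, let $\mathbb R^N_+=\mathbb R^{N-1}\times(0,\infty)$, and write $x=(x',x_N)$ and $\overline x=(x',-x_N)$ for $x\in\mathbb R^N$. Let $\sigma_N$ be the surface area of the unit sphere of $\mathbb R^N$, and put $$\Phi(x)=\frac{|x|^{2-N}}{(N-2)\sigma_N},\qquad G(x,y)=\Phi(x-y)+\Phi(\overline x-y).$$ Let $0<k<N-1$ and $p>0$. Let $\mu\not\equiv0$ be a (positive) Radon measure on $\mathbb R^N$ whose support is contained in the open half space $\mathbb R^N_+$ and whose Newtonian potential $U^\mu(x)=\int_{\mathbb R^N}\Phi(x-y)\,d\mu(y)$ is finite for every $x\in\mathbb R^N$. For $\lambda>0$ consider the problem $$-\Delta u=\mu\ \text{ in }\mathbb R^N_+,\qquad -\frac{\partial u}{\partial x_N}(x',0)=\lambda H_u(x')\ \text{ on }\partial\mathbb R^N_+,\qquad H_u(x')=\int_{\mathbb R^{N-1}}\frac{u(y',0)^p}{|x'-y'|^k}\,dy'.\tag{P}$$ A measurable function $u$ on $\overline{\mathbb R^N_+}$ is called a positive solution of (P) if: * $u>0$ a.e. in $\mathbb R^N_+$, and for almost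 every $x'\in\mathbb R^{N-1}$ the value $u(x',0)$ is finite and $u(z)\to u(x',0)$ as $z\to(x',0)$, $z\in\mathbb R^N_+$; * $H_u<\infty$ a.e. in $\mathbb R^{N-1}$, and $\int_{\mathbb R^{N-1}}\frac{H_u(y')}{|x-(y',0)|^{N-2}}\,dy'<\infty$ for almost every $x\in\mathbb R^N_+$; * for almost every $x\in\mathbb R^N_+$, $$u(x)=\int_{\mathbb R^N_+}G(x,y)\,d\mu(y)+\frac{2\lambda}{(N-2)\sigma_N}\int_{\mathbb R^{N-1}}\int_{\mathbb R^{N-1}}\frac{u(z',0)^p}{|x-(y',0)|^{N-2}|y'-z'|^k}\,dz'\,dy'.$$ Then: (i) If $0<k\le1$, or if $1<k<N-1$ and $0<p<\frac{N-1}{k-1}$, then for every $\lambda>0$ the problem (P) has no positive solution. (ii) If $1<k<N-1$ and $p=\frac{N-1}{k-1}$, then for every $\lambda>0$ the problem (P) has no positive solution $u$ with $u(\cdot,0)\in L^p(\mathbb R^{N-1})$. (iii) Suppose that $1<k<N-1$, $p>\frac{N-1}{k-1}$, and that there is a constant $C>0$ with $U^\mu(x)\le C(1+|x|)^{1-k}$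 for almost every $x\in\mathbb R^N$. Then there is $\lambda^*>0$ such that for every $0<\lambda<\lambda^*$ the problem (P) has a positive solution $u$ for which $$u-\int_{\mathbb R^N_+}G(\cdot,y)\,d\mu(y)\in C^{0,\gamma}\big(\overline{\mathbb R^N_+}\big)\quad\text{for some }\gamma\in(0,1),$$ that is, this difference is bounded and $\gamma$-Hölder continuous on $\overline{\mathbb R^N_+}$. -/

import Mathlib

open MeasureTheory Filter Topology Set
open scoped ENNReal NNReal

noncomputable section

namespace HalfSpace

/-! Throughout, `n` stands for `N - 1`: the half space lies in `ℝ^N = ℝ^(n+1)` and its boundary is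
identified with `ℝ^(N-1) = ℝ^n`. -/

/-- `ℝ^d` with its Euclidean norm. -/
abbrev Eucl (d : ℕ) : Type := EuclideanSpace ℝ (Fin d)

/-- The last coordinate `x_N` of `x = (x', x_N)`. -/
def height {n : ℕ} (x : Eucl (n + 1)) : ℝ := x (Fin.last n)

/-- The first `N - 1` coordinates `x'` of `x = (x', x_N)`. -/
def tang {n : ℕ} (x : Eucl (n + 1)) : Eucl n := WithLp.toLp 2 fun i => x i.castSucc

/-- The point `(x', t)`. -/
def point {n : ℕ} (x' : Eucl n) (t : ℝ) : Eucl (n + 1) :=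
  WithLp.toLp 2 (Fin.snoc (α := fun _ => ℝ) (fun i => x' i) t)

/-- The boundary point `(x', 0)`. -/
def bdry {n : ℕ} (x' : Eucl n) : Eucl (n + 1) := point x' 0

/-- The reflection `(x', -x_N)` of `x = (x', x_N)`. -/
def reflect {n : ℕ} (x : Eucl (n + 1)) : Eucl (n + 1) := point (tang x) (-height x)

/-- The open upper half space `x_N > 0`. -/
def upper (n : ℕ) : Set (Eucl (n + 1)) := {x | 0 < height x}

/-- The closed upper half space `x_N ≥ 0`. -/
def closedUpper (n : ℕ) : Set (Eucl (n + 1)) := {x | 0 ≤ height x}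

/-- `σ_N`, the surface area of the unit sphere of `ℝ^N`. -/
def sphereArea (n : ℕ) : ℝ :=
  (volume : Measure (Eucl (n + 1))).toSphere.real Set.univ

/-- The fundamental solution `Φ(x) = |x|^(2-N) / ((N-2) σ_N)`, with `Φ(0) = ∞`. -/
def fundSol {n : ℕ} (x : Eucl (n + 1)) : ℝ≥0∞ :=
  ENNReal.ofReal (1 / (((n : ℝ) - 1) * sphereArea n)) * ‖x‖ₑ ^ (1 - (n : ℝ))

/-- The Newtonian potential `U^μ(x) = ∫ Φ(x - y) dμ(y)`. -/
def newtonPotential {n : ℕ} (μ : Measure (Eucl (n + 1))) (x : Eucl (n + 1)) : ℝ≥0∞ :=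
  ∫⁻ y, fundSol (x - y) ∂μ

/-- The Neumann Green function `G(x, y) = Φ(x - y) + Φ(x̄ - y)` of the half space. -/
def green {n : ℕ} (x y : Eucl (n + 1)) : ℝ≥0∞ :=
  fundSol (x - y) + fundSol (reflect x - y)

/-- The Green potential of `μ`: the integral of `G(x, ·)` over the half space against `μ`. -/
def greenPotential {n : ℕ} (μ : Measure (Eucl (n + 1))) (x : Eucl (n + 1)) : ℝ≥0∞ :=
  ∫⁻ y in upper n, green x y ∂μ

/-- `H_u(x') = ∫ u(y', 0)^p / |x' - y'|^k dy'`, with values in `[0, ∞]`. -/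
def nonlocalTerm {n : ℕ} (k p : ℝ) (u : Eucl (n + 1) → ℝ) (x' : Eucl n) : ℝ≥0∞ :=
  ∫⁻ y' : Eucl n, ENNReal.ofReal (u (bdry y')) ^ p * ‖x' - y'‖ₑ ^ (-k)

/-- The integral over `ℝ^(N-1)` of `H_u(y') / |x - (y', 0)|^(N-2)`. -/
def liftedTerm {n : ℕ} (k p : ℝ) (u : Eucl (n + 1) → ℝ) (x : Eucl (n + 1)) : ℝ≥0∞ :=
  ∫⁻ y' : Eucl n, nonlocalTerm k p u y' * ‖x - bdry y'‖ₑ ^ (1 - (n : ℝ))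

/-- Positive solutions of `-Δu = μ` in the upper half space with the nonlocal boundary condition
`∂u/∂n (x', 0) = lam * ∫ u(y', 0)^p / |x' - y'|^k dy'`. Only the values of `u` on the closed half
space matter. -/
structure IsPositiveSolution {n : ℕ} (k p lam : ℝ) (μ : Measure (Eucl (n + 1)))
    (u : Eucl (n + 1) → ℝ) : Prop where
  /-- `u` is Lebesgue measurable in the half space. -/
  aemeasurable : AEMeasurable u (volume.restrict (upper n))
  /-- The boundary values are Lebesgue measurable. (This also follows from `aemeasurable` and
  `boundary_limit`, almost every boundary value being a limit of averages over small balls.) -/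
  aemeasurable_bdry : AEMeasurable (fun x' : Eucl n => u (bdry x')) volume
  pos : ∀ᵐ x ∂(volume.restrict (upper n)), 0 < u x
  /-- At almost every boundary point `u(x', 0)` is the limit of `u` from inside. -/
  boundary_limit : ∀ᵐ x' : Eucl n, Tendsto u (𝓝[upper n] (bdry x')) (𝓝 (u (bdry x')))
  nonlocal_finite : ∀ᵐ x' : Eucl n, nonlocalTerm k p u x' < ∞
  lifted_finite : ∀ᵐ x ∂(volume.restrict (upper n)), liftedTerm k p u x < ∞
  /-- The integral equation; both sides are elements of `[0, ∞]`, and the left one is finite. -/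
  equation : ∀ᵐ x ∂(volume.restrict (upper n)),
    ENNReal.ofReal (u x) = greenPotential μ x +
      ENNReal.ofReal (2 * lam / (((n : ℝ) - 1) * sphereArea n)) * liftedTerm k p u x

/-- `w ∈ C^{0,γ}(S)`: `w` is bounded on `S` and Hölder continuous on `S` with exponent `γ`. -/
def MemHolderSpace {n : ℕ} (γ : ℝ≥0) (S : Set (Eucl (n + 1))) (w : Eucl (n + 1) → ℝ) : Prop :=
  (∃ M : ℝ, ∀ x ∈ S, |w x| ≤ M) ∧ ∃ K : ℝ≥0, HolderOnWith K γ w S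

end HalfSpace

end

open HalfSpace

/-! All integrals are taken in `[0, ∞]`, so Tonelli and monotone convergence apply without
integrability checks.

Nonexistence. Let m(R) be the integral of u(y,0)^p over |y| < R. It is finite because `H_u` is
finite at some point, and m(1) > 0 because μ ≠ 0 makes the Newtonian potential bounded below on
balls. For |y| < R one has H_u(y) ≥ (2R)^(-k) m(R), hence the double integral is at least a constant
times R^(1-k) m(R) for |x| < R (`mul_bdryMass_le_liftedTerm`). Its finiteness at one point bounds
R^(1-k) m(R) for large R, while the integral equation, passed to the boundary by
`ae_le_bdry_of_ae_le`, gives u(y,0) ≥ c R^(1-k) m(R) for a.e. |y| < R. Taking p-th powers and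
integrating yields m(R) ≥ c R^n (R^(1-k) m(R))^p, which is contradictory for large R when p(k-1) <
n. At p(k-1) = n the pointwise bound makes u(y,0)^p at least of order |y|^(-n), so u(·,0) is not in
L^p. If k ≤ 1, the bound H_u(y) ≥ c|y|^(-k) at infinity already makes the outer integral diverge.

Existence. Integrating out y in |x-y|^(1-n) |y-z|^(-k) leaves at most C|x-z|^(-(k-1)). With w(z) =
(1+|z|)^(-(k-1)) and (k-1)p > n, the weight w^p is integrable, and integrating it against this
kernel gives at most a multiple of w (`exists_compositePotential_weight_le`). Thus a multiple of w
is a supersolution of the boundary equation for small λ, and monotone iteration from 0 produces a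
boundary function g. The integral formula extends g to the half space. Its nonlinear part is a layer
potential of a density of decay (1+|y|)^(-k) with k > 1, which is Hölder continuous
(`exists_layerPotential_bound_holder`). The Green potential is continuous at the boundary, which the
support of μ avoids. -/

theorem ENNReal.rpow_neg_le_rpow_neg {x y : ℝ≥0∞} {a : ℝ} (ha : 0 ≤ a) (h : x ≤ y) :
    y ^ (-a) ≤ x ^ (-a) := by
  rw [ENNReal.rpow_neg, ENNReal.rpow_neg]
  exact ENNReal.inv_le_inv.2 (ENNReal.rpow_le_rpow h ha)

theorem ENNReal.rpow_mul_rpow_neg_le_one (x : ℝ≥0∞) (a : ℝ) : x ^ a * x ^ (-a) ≤ 1 := by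
  rw [ENNReal.rpow_neg]
  exact ENNReal.mul_inv_le_one _

theorem ENNReal.one_add_enorm_ne_top {E : Type*} [NormedAddCommGroup E] (x : E) :
    1 + ‖x‖ₑ ≠ ∞ := by simp

/-! ### Integrals of power weights and the composition of Riesz kernels -/

namespace HalfSpace

variable {d : ℕ}

theorem lintegral_ball_enorm_rpow_neg_lt_top {b : ℝ} (hb0 : 0 ≤ b) (hb : b < d) :
    ∫⁻ w : Eucl d in Metric.ball 0 1, ‖w‖ₑ ^ (-b) < ∞ := by
  have hd : 1 ≤ d := by
    rcases Nat.eq_zero_or_pos d with h | h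
    · subst h; norm_num at hb; linarith
    · exact h
  have : Nonempty (Fin d) := ⟨⟨0, hd⟩⟩
  have h1 : IntegrableOn (fun w : Eucl d => (fun t : ℝ => t ^ (-b)) ‖w‖) (Metric.ball 0 1) := by
    refine (integrableOn_fun_norm_addHaar volume (f := fun t : ℝ => t ^ (-b))).2 ?_
    have h2 : IntegrableOn (fun t : ℝ => t ^ ((d : ℝ) - 1 - b)) (Ioo 0 1) :=
      (intervalIntegral.integrableOn_Ioo_rpow_iff one_pos).2 (by linarith)
    refine h2.congr_fun (fun t ht => ?_) measurableSet_Ioo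
    simp only [finrank_euclideanSpace, Fintype.card_fin, smul_eq_mul]
    rw [← Real.rpow_natCast, ← Real.rpow_add ht.1, Nat.cast_sub hd]
    congr 1; push_cast; ring
  refine lt_of_le_of_lt (lintegral_mono_ae ?_) h1.2
  have h0 : ∀ᵐ w : Eucl d, w ≠ 0 := by
    simp [ae_iff, measure_singleton]
  filter_upwards [ae_restrict_of_ae h0] with w hw
  have : 0 < ‖w‖ := norm_pos_iff.2 hw
  rw [Real.enorm_of_nonneg (by positivity), ← ofReal_norm,
    ENNReal.ofReal_rpow_of_pos this]

theorem lintegral_one_add_enorm_rpow_neg_lt_top {a : ℝ} (ha : d < a) :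
    ∫⁻ w : Eucl d, (1 + ‖w‖ₑ) ^ (-a) < ∞ := by
  have h := finite_integral_one_add_norm (E := Eucl d) (μ := volume) (r := a) (by simpa using ha)
  refine lt_of_le_of_lt (lintegral_mono fun w => le_of_eq ?_) h
  rw [← ENNReal.ofReal_rpow_of_pos (by positivity), ENNReal.ofReal_add zero_le_one (norm_nonneg _),
    ofReal_norm, ENNReal.ofReal_one]

/-- Replacing both bases by the smaller one can only increase the product. This separates two
weights centred at different points, each then integrable by itself. -/
theorem rpow_neg_mul_rpow_neg_le {A B : ℝ≥0∞} {a b : ℝ} (ha : 0 ≤ a) (hb : 0 ≤ b)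
    (hA : 1 ≤ A) (hB : 1 ≤ B) (hAt : A ≠ ∞) (hBt : B ≠ ∞) :
    A ^ (-a) * B ^ (-b) ≤ A ^ (-(a + b)) + B ^ (-(a + b)) := by
  have e : ∀ {X : ℝ≥0∞}, 1 ≤ X → X ≠ ∞ → X ^ (-(a + b)) = X ^ (-a) * X ^ (-b) := fun {X} h1 h2 => by
    rw [← ENNReal.rpow_add _ _ (by positivity) h2]; congr 1; ring
  rcases le_total A B with h | h
  · refine le_trans ?_ le_self_add
    rw [e hA hAt]
    gcongr 1
    exact ENNReal.rpow_neg_le_rpow_neg hb h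
  · refine le_trans ?_ le_add_self
    rw [e hB hBt]
    gcongr 1
    exact ENNReal.rpow_neg_le_rpow_neg ha h

theorem rpow_neg_le_of_half_le {X : ℝ≥0∞} {b : ℝ} (hb : 0 ≤ b) {c : ℝ≥0∞} (hc0 : c ≠ 0)
    (hct : c ≠ ∞) {Y : ℝ≥0∞} (h : Y ≤ c * X) : X ^ (-b) ≤ c ^ b * Y ^ (-b) := by
  have h1 : (c * X) ^ (-b) ≤ Y ^ (-b) := ENNReal.rpow_neg_le_rpow_neg hb h
  calc X ^ (-b) = c ^ b * (c ^ (-b) * X ^ (-b)) := by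
        rw [← mul_assoc, ← ENNReal.rpow_add _ _ hc0 hct]; simp
    _ ≤ c ^ b * Y ^ (-b) := by
        gcongr
        refine le_trans (le_of_eq ?_) h1
        rw [ENNReal.rpow_neg c, ENNReal.rpow_neg X, ENNReal.rpow_neg (c * X),
          ENNReal.mul_rpow_of_nonneg _ _ hb, ENNReal.mul_inv]
        · left; simp [hc0, hct]
        · left; exact ENNReal.rpow_ne_top_of_nonneg hb hct

/-- Within distance 1 of x the weight is at most 1 and the singularity is integrable since b < d.
Farther away |x-z| is comparable to 1+|x-z|, and the product is dominated by two weights of exponent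
a+b > d. Translation invariance makes the bound uniform in x. -/
theorem exists_lintegral_weight_mul_enorm_rpow_le {a b : ℝ} (ha : 0 ≤ a) (hb0 : 0 ≤ b) (hb : b < d)
    (hab : d < a + b) :
    ∃ C : ℝ≥0∞, C < ∞ ∧ ∀ x : Eucl d, ∫⁻ z, (1 + ‖z‖ₑ) ^ (-a) * ‖x - z‖ₑ ^ (-b) ≤ C := by
  set I₁ := ∫⁻ w : Eucl d in Metric.ball 0 1, ‖w‖ₑ ^ (-b)
  set I₂ := ∫⁻ w : Eucl d, (1 + ‖w‖ₑ) ^ (-(a + b))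
  have h1 : I₁ < ∞ := lintegral_ball_enorm_rpow_neg_lt_top hb0 hb
  have h2 : I₂ < ∞ := lintegral_one_add_enorm_rpow_neg_lt_top hab
  have h2b : (2 : ℝ≥0∞) ^ b < ∞ := ENNReal.rpow_lt_top_of_nonneg hb0 (by simp)
  refine ⟨I₁ + 2 ^ b * (I₂ + I₂), by finiteness, fun x => ?_⟩
  set g : Eucl d → ℝ≥0∞ := (Metric.ball 0 1).indicator fun w => ‖w‖ₑ ^ (-b)
  have hg : Measurable g := Measurable.indicator (by fun_prop) Metric.isOpen_ball.measurableSet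
  have key : ∀ z : Eucl d, (1 + ‖z‖ₑ) ^ (-a) * ‖x - z‖ₑ ^ (-b) ≤
      g (x - z) + 2 ^ b * ((1 + ‖z‖ₑ) ^ (-(a + b)) + (1 + ‖x - z‖ₑ) ^ (-(a + b))) := by
    intro z
    by_cases hz : x - z ∈ Metric.ball (0 : Eucl d) 1
    · refine le_trans ?_ le_self_add
      simp only [g, indicator_of_mem hz]
      have : (1 + ‖z‖ₑ) ^ (-a) ≤ 1 := by
        simpa using ENNReal.rpow_neg_le_rpow_neg ha (le_self_add : (1 : ℝ≥0∞) ≤ 1 + ‖z‖ₑ)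
      simpa using mul_le_mul_left this (‖x - z‖ₑ ^ (-b))
    · refine le_trans ?_ le_add_self
      have h1 : 1 ≤ ‖x - z‖ₑ := by
        rw [← ofReal_norm, ENNReal.one_le_ofReal]
        simpa using hz
      have := rpow_neg_le_of_half_le (X := ‖x - z‖ₑ) (Y := 1 + ‖x - z‖ₑ) hb0 two_ne_zero
        ENNReal.ofNat_ne_top (by rw [two_mul]; gcongr)
      calc (1 + ‖z‖ₑ) ^ (-a) * ‖x - z‖ₑ ^ (-b)
          ≤ (1 + ‖z‖ₑ) ^ (-a) * (2 ^ b * (1 + ‖x - z‖ₑ) ^ (-b)) := by gcongr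
        _ = 2 ^ b * ((1 + ‖z‖ₑ) ^ (-a) * (1 + ‖x - z‖ₑ) ^ (-b)) := by ring
        _ ≤ _ := by
          gcongr
          exact rpow_neg_mul_rpow_neg_le ha hb0 le_self_add le_self_add
            (ENNReal.one_add_enorm_ne_top _) (ENNReal.one_add_enorm_ne_top _)
  refine (lintegral_mono key).trans (le_of_eq ?_)
  rw [lintegral_add_left (by fun_prop), lintegral_const_mul _ (by fun_prop),
    lintegral_add_left (by fun_prop), lintegral_sub_left_eq_self g x,
    lintegral_sub_left_eq_self (fun w : Eucl d => (1 + ‖w‖ₑ) ^ (-(a + b))) x,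
    lintegral_indicator Metric.isOpen_ball.measurableSet]

theorem add_rpow_le_two_rpow_mul {A B : ℝ≥0∞} {b : ℝ} (hb : 0 ≤ b) :
    (A + B) ^ b ≤ 2 ^ b * (A ^ b + B ^ b) := by
  have : A + B ≤ 2 * max A B := by
    rw [two_mul]; gcongr <;> simp
  refine (ENNReal.rpow_le_rpow this hb).trans ?_
  rw [ENNReal.mul_rpow_of_nonneg _ _ hb]
  gcongr
  rcases le_total A B with h | h
  · rw [max_eq_right h]; exact le_add_self
  · rw [max_eq_left h]; exact le_self_add

/-- Multiply by (1+|x|)^b and split it by the triangle inequality. The part (1+|z|)^b lowers the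
weight exponent to s-b, whose sum with b still exceeds d; the part |x-z|^b cancels the kernel and
leaves an integrable weight. -/
theorem exists_lintegral_weight_mul_enorm_rpow_le_weight {s b : ℝ} (hs : d < s) (hb0 : 0 ≤ b)
    (hb : b < d) :
    ∃ C : ℝ≥0∞, C < ∞ ∧ ∀ x : Eucl d,
      ∫⁻ z, (1 + ‖z‖ₑ) ^ (-s) * ‖x - z‖ₑ ^ (-b) ≤ C * (1 + ‖x‖ₑ) ^ (-b) := by
  obtain ⟨C₁, hC₁, h1⟩ := exists_lintegral_weight_mul_enorm_rpow_le (d := d) (a := s - b) (b := b)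
    (by linarith) hb0 hb (by linarith)
  set I := ∫⁻ w : Eucl d, (1 + ‖w‖ₑ) ^ (-s)
  have h2 : I < ∞ := lintegral_one_add_enorm_rpow_neg_lt_top hs
  have h2b : (2 : ℝ≥0∞) ^ b < ∞ := ENNReal.rpow_lt_top_of_nonneg hb0 (by simp)
  refine ⟨2 ^ b * (C₁ + I), by finiteness, fun x => ?_⟩
  have hx0 : (1 + ‖x‖ₑ) ^ b ≠ 0 := by
    simp [ENNReal.rpow_eq_zero_iff]
  have hxt : (1 + ‖x‖ₑ) ^ b ≠ ∞ :=
    ENNReal.rpow_ne_top_of_nonneg hb0 (ENNReal.one_add_enorm_ne_top x)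
  rw [ENNReal.rpow_neg, ← div_eq_mul_inv, ENNReal.le_div_iff_mul_le (Or.inl hx0) (Or.inl hxt),
    ← lintegral_mul_const _ (by fun_prop)]
  have key : ∀ z : Eucl d, (1 + ‖z‖ₑ) ^ (-s) * ‖x - z‖ₑ ^ (-b) * (1 + ‖x‖ₑ) ^ b ≤
      2 ^ b * ((1 + ‖z‖ₑ) ^ (-(s - b)) * ‖x - z‖ₑ ^ (-b) + (1 + ‖z‖ₑ) ^ (-s)) := by
    intro z
    have hx : 1 + ‖x‖ₑ ≤ (1 + ‖z‖ₑ) + ‖x - z‖ₑ := by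
      have : ‖x‖ₑ ≤ ‖z‖ₑ + ‖x - z‖ₑ := by
        simpa using enorm_add_le z (x - z)
      rw [add_assoc]; gcongr
    have h3 : (1 + ‖x‖ₑ) ^ b ≤ 2 ^ b * ((1 + ‖z‖ₑ) ^ b + ‖x - z‖ₑ ^ b) :=
      (ENNReal.rpow_le_rpow hx hb0).trans (add_rpow_le_two_rpow_mul hb0)
    calc (1 + ‖z‖ₑ) ^ (-s) * ‖x - z‖ₑ ^ (-b) * (1 + ‖x‖ₑ) ^ b
        ≤ (1 + ‖z‖ₑ) ^ (-s) * ‖x - z‖ₑ ^ (-b) * (2 ^ b * ((1 + ‖z‖ₑ) ^ b + ‖x - z‖ₑ ^ b)) := by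
          gcongr
      _ = 2 ^ b * ((1 + ‖z‖ₑ) ^ (-s) * (1 + ‖z‖ₑ) ^ b * ‖x - z‖ₑ ^ (-b) +
            (1 + ‖z‖ₑ) ^ (-s) * (‖x - z‖ₑ ^ b * ‖x - z‖ₑ ^ (-b))) := by ring
      _ ≤ 2 ^ b * ((1 + ‖z‖ₑ) ^ (-(s - b)) * ‖x - z‖ₑ ^ (-b) + (1 + ‖z‖ₑ) ^ (-s) * 1) := by
          gcongr
          · rw [← ENNReal.rpow_add _ _ (by simp) (ENNReal.one_add_enorm_ne_top z)]
            apply le_of_eq; congr 1; ring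
          · exact ENNReal.rpow_mul_rpow_neg_le_one _ _
      _ = _ := by rw [mul_one]
  refine (lintegral_mono key).trans ?_
  rw [lintegral_const_mul _ (by fun_prop), lintegral_add_right _ (by fun_prop)]
  gcongr
  exact h1 x

theorem lintegral_eq_rpow_mul_lintegral_comp_smul {r : ℝ} (hr : 0 < r) {g : Eucl d → ℝ≥0∞}
    (hg : Measurable g) :
    ∫⁻ y, g y = ENNReal.ofReal r ^ (d : ℝ) * ∫⁻ w, g (r • w) := by
  have h := Measure.map_addHaar_smul (volume : Measure (Eucl d)) hr.ne'
  have h2 : ∫⁻ w, g (r • w) = ∫⁻ y, g y ∂(Measure.map (r • ·) volume) :=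
    (lintegral_map hg (measurable_const_smul r)).symm
  rw [h2, h, lintegral_smul_measure, smul_eq_mul, ← mul_assoc, finrank_euclideanSpace,
    Fintype.card_fin, abs_of_pos (by positivity), ENNReal.ofReal_inv_of_pos (by positivity),
    ENNReal.ofReal_pow hr.le, ENNReal.rpow_natCast, ENNReal.mul_inv_cancel, one_mul]
  · simpa using fun h => absurd h (not_le.2 hr)
  · finiteness

/-- Translation by z and scaling by |x-z| reduce to a unit vector e in place of x and 0 in place of
z. The points 0 and e cannot both be within 1/2 of w, so one of the two kernels is always comparable
to a nonsingular weight. -/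
theorem exists_lintegral_enorm_rpow_mul_enorm_rpow_le {a b : ℝ} (ha0 : 0 ≤ a) (ha : a < d)
    (hb0 : 0 ≤ b) (hb : b < d) (hab : d < a + b) :
    ∃ C : ℝ≥0∞, C < ∞ ∧ ∀ x z : Eucl d,
      ∫⁻ y, ‖x - y‖ₑ ^ (-a) * ‖y - z‖ₑ ^ (-b) ≤ C * ‖x - z‖ₑ ^ (-(a + b - d)) := by
  obtain ⟨C₁, hC₁, h1⟩ := exists_lintegral_weight_mul_enorm_rpow_le (d := d) hb0 ha0 ha (by linarith)
  obtain ⟨C₂, hC₂, h2⟩ := exists_lintegral_weight_mul_enorm_rpow_le (d := d) ha0 hb0 hb hab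
  have h3a : (3 : ℝ≥0∞) ^ a < ∞ := ENNReal.rpow_lt_top_of_nonneg ha0 (by simp)
  have h3b : (3 : ℝ≥0∞) ^ b < ∞ := ENNReal.rpow_lt_top_of_nonneg hb0 (by simp)
  -- The summand 1 keeps C nonzero, so that for x = z the right-hand side is C * ∞ = ∞ rather than 0
  -- * ∞ = 0.
  set C : ℝ≥0∞ := 3 ^ b * C₁ + 3 ^ a * C₂ + 1
  have unit : ∀ e : Eucl d, ‖e‖ = 1 → ∫⁻ w, ‖e - w‖ₑ ^ (-a) * ‖w‖ₑ ^ (-b) ≤ C := by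
    intro e he
    have key : ∀ w : Eucl d, ‖e - w‖ₑ ^ (-a) * ‖w‖ₑ ^ (-b) ≤
        3 ^ b * ((1 + ‖w‖ₑ) ^ (-b) * ‖e - w‖ₑ ^ (-a)) +
          3 ^ a * ((1 + ‖e - w‖ₑ) ^ (-a) * ‖e - (e - w)‖ₑ ^ (-b)) := by
      intro w
      have far : ∀ v : Eucl d, 1 / 2 ≤ ‖v‖ → 1 + ‖v‖ₑ ≤ 3 * ‖v‖ₑ := by
        intro v hv
        rw [← ofReal_norm, ← ENNReal.ofReal_one,
          ← ENNReal.ofReal_add zero_le_one (norm_nonneg _),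
          show (3 : ℝ≥0∞) = ENNReal.ofReal 3 by simp, ← ENNReal.ofReal_mul (by norm_num)]
        apply ENNReal.ofReal_le_ofReal
        linarith
      by_cases hw : 1 / 2 ≤ ‖w‖
      · refine le_trans ?_ le_self_add
        have := rpow_neg_le_of_half_le hb0 three_ne_zero ENNReal.ofNat_ne_top (far w hw)
        calc ‖e - w‖ₑ ^ (-a) * ‖w‖ₑ ^ (-b)
            ≤ ‖e - w‖ₑ ^ (-a) * (3 ^ b * (1 + ‖w‖ₑ) ^ (-b)) := by gcongr
          _ = _ := by ring
      · refine le_trans ?_ le_add_self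
        have hew : 1 / 2 ≤ ‖e - w‖ := by
          have := norm_sub_norm_le e w
          linarith
        have := rpow_neg_le_of_half_le ha0 three_ne_zero ENNReal.ofNat_ne_top (far _ hew)
        rw [sub_sub_cancel]
        calc ‖e - w‖ₑ ^ (-a) * ‖w‖ₑ ^ (-b)
            ≤ (3 ^ a * (1 + ‖e - w‖ₑ) ^ (-a)) * ‖w‖ₑ ^ (-b) := by gcongr
          _ = _ := by ring
    refine (lintegral_mono key).trans ?_
    rw [lintegral_add_left (by fun_prop), lintegral_const_mul _ (by fun_prop),
      lintegral_const_mul _ (by fun_prop),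
      lintegral_sub_left_eq_self (fun v : Eucl d => (1 + ‖v‖ₑ) ^ (-a) * ‖e - v‖ₑ ^ (-b)) e]
    refine le_trans ?_ (le_self_add : 3 ^ b * C₁ + 3 ^ a * C₂ ≤ C)
    gcongr
    · exact h1 e
    · exact h2 e
  refine ⟨C, by finiteness, fun x z => ?_⟩
  rcases eq_or_ne x z with rfl | hxz
  · have hC : C ≠ 0 := by simp [C]
    rw [sub_self, enorm_zero, ENNReal.zero_rpow_of_neg (by linarith), ENNReal.mul_top hC]
    exact le_top
  have hr : 0 < ‖x - z‖ := norm_pos_iff.2 (sub_ne_zero.2 hxz)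
  set r := ‖x - z‖ with hr_def
  set e : Eucl d := r⁻¹ • (x - z) with he_def
  have he : ‖e‖ = 1 := by
    rw [he_def, norm_smul, norm_inv, Real.norm_of_nonneg hr.le, ← hr_def, inv_mul_cancel₀ hr.ne']
  have hre : r • e = x - z := by rw [he_def, smul_smul, mul_inv_cancel₀ hr.ne', one_smul]
  have hr0 : ENNReal.ofReal r ≠ 0 := by simpa using hr
  have hrt : ENNReal.ofReal r ≠ ∞ := ENNReal.ofReal_ne_top
  have hE : ∀ (v : Eucl d) {c : ℝ}, 0 ≤ c →
      ‖r • v‖ₑ ^ (-c) = ENNReal.ofReal r ^ (-c) * ‖v‖ₑ ^ (-c) := by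
    intro v c hc
    rw [enorm_smul, Real.enorm_of_nonneg hr.le, ENNReal.rpow_neg, ENNReal.rpow_neg,
      ENNReal.rpow_neg, ENNReal.mul_rpow_of_nonneg _ _ hc, ENNReal.mul_inv]
    · left; simp [hr]
    · left; finiteness
  calc ∫⁻ y, ‖x - y‖ₑ ^ (-a) * ‖y - z‖ₑ ^ (-b)
      = ∫⁻ y, ‖r • e - y‖ₑ ^ (-a) * ‖y‖ₑ ^ (-b) := by
        rw [← lintegral_sub_right_eq_self (fun y : Eucl d => ‖r • e - y‖ₑ ^ (-a) * ‖y‖ₑ ^ (-b)) z]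
        simp [hre]
    _ = ENNReal.ofReal r ^ (d : ℝ) * ∫⁻ w, ‖r • e - r • w‖ₑ ^ (-a) * ‖r • w‖ₑ ^ (-b) :=
        lintegral_eq_rpow_mul_lintegral_comp_smul hr (by fun_prop)
    _ = ENNReal.ofReal r ^ (d : ℝ) * ∫⁻ w, ENNReal.ofReal r ^ (-a) * ENNReal.ofReal r ^ (-b) *
          (‖e - w‖ₑ ^ (-a) * ‖w‖ₑ ^ (-b)) := by
        congr 1
        refine lintegral_congr fun w => ?_
        rw [← smul_sub, hE _ ha0, hE _ hb0]
        ring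
    _ = ENNReal.ofReal r ^ (-(a + b - d)) * ∫⁻ w, ‖e - w‖ₑ ^ (-a) * ‖w‖ₑ ^ (-b) := by
        rw [lintegral_const_mul _ (by fun_prop), ← mul_assoc, ← ENNReal.rpow_add _ _ hr0 hrt,
          ← ENNReal.rpow_add _ _ hr0 hrt]
        congr 2; ring
    _ ≤ C * ‖x - z‖ₑ ^ (-(a + b - d)) := by
        rw [mul_comm, ← ofReal_norm]
        gcongr
        exact unit e he

end HalfSpace

/-! ### Coordinates of the half space -/

namespace HalfSpace

variable {n : ℕ}

theorem continuous_height : Continuous (height (n := n)) := by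
  unfold height; fun_prop

theorem continuous_tang : Continuous (tang (n := n)) := by
  unfold tang; fun_prop

theorem continuous_point : Continuous fun q : Eucl n × ℝ => point q.1 q.2 := by
  unfold point
  refine (PiLp.continuous_toLp 2 _).comp (continuous_pi fun i => ?_)
  refine Fin.lastCases ?_ (fun j => ?_) i
  · simpa using continuous_snd
  · simp only [Fin.snoc_castSucc]; fun_prop

theorem continuous_bdry : Continuous (bdry (n := n)) :=
  continuous_point.comp (Continuous.prodMk continuous_id continuous_const)

theorem continuous_reflect : Continuous (reflect (n := n)) :=
  continuous_point.comp (Continuous.prodMk continuous_tang continuous_height.neg)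

theorem isOpen_upper : IsOpen (upper n) := isOpen_lt continuous_const continuous_height

@[simp] theorem height_point (x' : Eucl n) (t : ℝ) : height (point x' t) = t := by
  simp [height, point]

@[simp] theorem tang_point (x' : Eucl n) (t : ℝ) : tang (point x' t) = x' := by
  ext i; simp [tang, point]

@[simp] theorem tang_bdry (x' : Eucl n) : tang (bdry x') = x' := tang_point x' 0

@[simp] theorem height_bdry (x' : Eucl n) : height (bdry x') = 0 := height_point x' 0

@[simp] theorem reflect_bdry (x' : Eucl n) : reflect (bdry x') = bdry x' := by
  simp [reflect, bdry]

theorem bdry_notMem_upper (x' : Eucl n) : bdry x' ∉ upper n := by simp [upper]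

theorem norm_sq_eq_tang_add_height (x : Eucl (n + 1)) : ‖x‖ ^ 2 = ‖tang x‖ ^ 2 + height x ^ 2 := by
  rw [EuclideanSpace.norm_sq_eq, EuclideanSpace.norm_sq_eq, Fin.sum_univ_castSucc]
  simp [tang, height]

theorem norm_tang_le (x : Eucl (n + 1)) : ‖tang x‖ ≤ ‖x‖ :=
  (sq_le_sq₀ (norm_nonneg _) (norm_nonneg _)).1
    (by rw [norm_sq_eq_tang_add_height x]; nlinarith [sq_nonneg (height x)])

theorem tang_sub (x y : Eucl (n + 1)) : tang (x - y) = tang x - tang y := by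
  ext i; simp [tang]

theorem bdry_sub (x y : Eucl n) : bdry (x - y) = bdry x - bdry y := by
  ext i; refine Fin.lastCases ?_ (fun j => ?_) i <;> simp [bdry, point]

@[simp] theorem norm_bdry (x : Eucl n) : ‖bdry x‖ = ‖x‖ := by
  have := norm_sq_eq_tang_add_height (bdry x)
  simp only [tang_bdry, height_bdry, ne_eq, OfNat.ofNat_ne_zero, not_false_eq_true, zero_pow,
    add_zero] at this
  exact (pow_left_inj₀ (norm_nonneg _) (norm_nonneg _) two_ne_zero).1 this

theorem enorm_tang_sub_le (x : Eucl (n + 1)) (y : Eucl n) : ‖tang x - y‖ₑ ≤ ‖x - bdry y‖ₑ := by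
  rw [← ofReal_norm, ← ofReal_norm]
  apply ENNReal.ofReal_le_ofReal
  simpa [tang_sub] using norm_tang_le (x - bdry y)

theorem enorm_bdry_sub (x y : Eucl n) : ‖bdry x - bdry y‖ₑ = ‖x - y‖ₑ := by
  rw [← ofReal_norm, ← ofReal_norm, ← bdry_sub, norm_bdry]

theorem bdry_mem_closure_upper (x' : Eucl n) : bdry x' ∈ closure (upper n) := by
  have h : Tendsto (fun t : ℝ => point x' t) (𝓝[>] 0) (𝓝 (bdry x')) :=
    ((continuous_point.comp (Continuous.prodMk continuous_const continuous_id)).tendsto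
      (0 : ℝ)).mono_left nhdsWithin_le_nhds
  refine mem_closure_of_tendsto h ?_
  filter_upwards [self_mem_nhdsWithin] with t ht
  simpa [upper] using ht

theorem sphereArea_pos : 0 < sphereArea n := by
  rw [sphereArea, Measure.toSphere_real_apply_univ]
  have : 0 < (volume : Measure (Eucl (n + 1))).real (Metric.ball 0 1) :=
    ENNReal.toReal_pos (Metric.measure_ball_pos _ _ one_pos).ne' measure_ball_lt_top.ne
  have h2 : (0 : ℝ) < Module.finrank ℝ (Eucl (n + 1)) := by
    rw [finrank_euclideanSpace, Fintype.card_fin]; positivity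
  positivity

/-! ### Hölder continuity of single layer potentials -/

/-- Only |X| < |Y| matters. With t = |X|/|Y|, Bernoulli gives 1 - t^m ≤ m(1-t), and 1-t ≤ (1-t)^γ ≤
(|X-Y|/|X|)^γ. The error is singular at X alone; the two-sided estimate comes later by exchanging
the points. -/
theorem enorm_rpow_neg_le_add {E : Type*} [NormedAddCommGroup E] {m γ : ℝ} (hm : 1 ≤ m)
    (hγ0 : 0 < γ) (hγ1 : γ ≤ 1) (X Y : E) :
    ‖X‖ₑ ^ (-m) ≤ ‖Y‖ₑ ^ (-m) + ENNReal.ofReal m * ‖X - Y‖ₑ ^ γ * ‖X‖ₑ ^ (-(m + γ)) := by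
  rcases le_or_gt ‖Y‖ ‖X‖ with h | h
  · refine le_trans (ENNReal.rpow_neg_le_rpow_neg (by linarith) ?_) le_self_add
    rw [← ofReal_norm, ← ofReal_norm]
    exact ENNReal.ofReal_le_ofReal h
  have hXY : X ≠ Y := fun e => by simp [e] at h
  have hd : 0 < ‖X - Y‖ := norm_pos_iff.2 (sub_ne_zero.2 hXY)
  rcases (norm_nonneg X).eq_or_lt with hX | ha
  · have : ‖X‖ₑ = 0 := by rw [← ofReal_norm, ← hX, ENNReal.ofReal_zero]
    rw [this, ENNReal.zero_rpow_of_neg (y := -(m + γ)) (by linarith), ENNReal.mul_top, add_top]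
    · exact le_top
    · refine mul_ne_zero (by simpa using by linarith) ?_
      rw [← ofReal_norm, ENNReal.ofReal_rpow_of_pos hd]
      simpa using Real.rpow_pos_of_pos hd γ
  have hb : 0 < ‖Y‖ := ha.trans h
  rw [← ofReal_norm, ← ofReal_norm, ← ofReal_norm, ENNReal.ofReal_rpow_of_pos ha,
    ENNReal.ofReal_rpow_of_pos hb, ENNReal.ofReal_rpow_of_pos hd, ENNReal.ofReal_rpow_of_pos ha,
    ← ENNReal.ofReal_mul (by linarith), ← ENNReal.ofReal_mul (by positivity),
    ← ENNReal.ofReal_add (by positivity) (by positivity)]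
  apply ENNReal.ofReal_le_ofReal
  have hab : ‖Y‖ - ‖X‖ ≤ ‖X - Y‖ := by
    rw [norm_sub_rev]; exact norm_sub_norm_le Y X
  set a := ‖X‖
  set b := ‖Y‖
  have ht1 : a / b ≤ 1 := (div_le_one hb).2 h.le
  have ht0 : 0 < a / b := by positivity
  have h1 : 1 - (a / b) ^ m ≤ m * (1 - a / b) := by
    have := one_add_mul_self_le_rpow_one_add (s := a / b - 1) (by linarith) hm
    rw [add_sub_cancel] at this
    linarith
  have h2 : 1 - a / b ≤ ‖X - Y‖ ^ γ * a ^ (-γ) := by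
    calc 1 - a / b = (1 - a / b) ^ (1 : ℝ) := (Real.rpow_one _).symm
      _ ≤ (1 - a / b) ^ γ := by
        rcases (sub_nonneg.2 ht1).eq_or_lt with h0 | h0
        · rw [← h0, Real.zero_rpow one_ne_zero, Real.zero_rpow hγ0.ne']
        · exact Real.rpow_le_rpow_of_exponent_ge h0 (by linarith) hγ1
      _ ≤ (‖X - Y‖ / a) ^ γ := by
        apply Real.rpow_le_rpow (by linarith) _ hγ0.le
        calc 1 - a / b = (b - a) / b := by field_simp
          _ ≤ (b - a) / a := div_le_div_of_nonneg_left (by linarith) ha h.le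
          _ ≤ ‖X - Y‖ / a := by gcongr
      _ = ‖X - Y‖ ^ γ * a ^ (-γ) := by
        rw [Real.div_rpow hd.le ha.le, Real.rpow_neg ha.le, div_eq_mul_inv]
  have h3 : b ^ (-m) = a ^ (-m) * (a / b) ^ m := by
    rw [Real.div_rpow ha.le hb.le, Real.rpow_neg ha.le, Real.rpow_neg hb.le]
    have := Real.rpow_pos_of_pos ha m
    field_simp
  rw [h3, neg_add, Real.rpow_add ha]
  have h4 : 0 < a ^ (-m) := Real.rpow_pos_of_pos ha _
  have h5 : 1 - (a / b) ^ m ≤ m * (‖X - Y‖ ^ γ * a ^ (-γ)) := h1.trans (by gcongr)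
  nlinarith [mul_le_mul_of_nonneg_left h5 h4.le]

/-- The single layer potential `∫ h(y) |x - (y, 0)|^(1-n) dy` of a density on the boundary. -/
noncomputable def layerPotential (h : Eucl n → ℝ≥0∞) (x : Eucl (n + 1)) : ℝ≥0∞ :=
  ∫⁻ y : Eucl n, h y * ‖x - bdry y‖ₑ ^ (1 - (n : ℝ))

theorem measurable_bdry : Measurable (bdry (n := n)) := continuous_bdry.measurable

theorem measurable_layerPotential {h : Eucl n → ℝ≥0∞} (hh : Measurable h) :
    Measurable (layerPotential h) := by
  have hb := measurable_bdry (n := n)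
  refine Measurable.lintegral_prod_right'
    (f := fun q : Eucl (n + 1) × Eucl n => h q.2 * ‖q.1 - bdry q.2‖ₑ ^ (1 - (n : ℝ))) ?_
  fun_prop

theorem exists_layerPotential_le {h : Eucl n → ℝ≥0∞} {a b : ℝ} {D : ℝ≥0∞} (ha : 0 ≤ a) (hb0 : 0 ≤ b)
    (hb : b < n) (hab : n < a + b) (hD : D < ∞) (hh : ∀ y, h y ≤ D * (1 + ‖y‖ₑ) ^ (-a)) :
    ∃ M : ℝ≥0∞, M < ∞ ∧ ∀ x : Eucl (n + 1), ∫⁻ y, h y * ‖x - bdry y‖ₑ ^ (-b) ≤ M := by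
  obtain ⟨C, hC, h1⟩ := exists_lintegral_weight_mul_enorm_rpow_le ha hb0 hb hab
  refine ⟨D * C, by finiteness, fun x => ?_⟩
  calc ∫⁻ y, h y * ‖x - bdry y‖ₑ ^ (-b)
      ≤ ∫⁻ y, D * ((1 + ‖y‖ₑ) ^ (-a) * ‖tang x - y‖ₑ ^ (-b)) := by
        refine lintegral_mono fun y => ?_
        rw [← mul_assoc]
        exact mul_le_mul' (hh y) (ENNReal.rpow_neg_le_rpow_neg hb0 (enorm_tang_sub_le x y))
    _ = D * ∫⁻ y, (1 + ‖y‖ₑ) ^ (-a) * ‖tang x - y‖ₑ ^ (-b) :=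
        lintegral_const_mul _ (by fun_prop)
    _ ≤ D * C := by gcongr; exact h1 _

/-- The Hölder error raises the kernel exponent from n-1 to n-1+γ, still below n because γ < 1; a >
1 supplies the decay at infinity. Both integrals are then bounded uniformly, the worst case being x
on the boundary. -/
theorem exists_layerPotential_bound_holder (hn : 2 ≤ n) {h : Eucl n → ℝ≥0∞} (hm : Measurable h)
    {a γ : ℝ} {D : ℝ≥0∞} (ha : 1 < a) (hγ0 : 0 < γ) (hγ1 : γ < 1) (hD : D < ∞)
    (hh : ∀ y, h y ≤ D * (1 + ‖y‖ₑ) ^ (-a)) :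
    ∃ M K : ℝ≥0∞, M < ∞ ∧ K < ∞ ∧ (∀ x, layerPotential h x ≤ M) ∧
      ∀ x z, layerPotential h x ≤ layerPotential h z + K * ‖x - z‖ₑ ^ γ := by
  have hn' : (2 : ℝ) ≤ n := by exact_mod_cast hn
  have he : (1 - (n : ℝ)) = -((n : ℝ) - 1) := by ring
  have hb := measurable_bdry (n := n)
  obtain ⟨M, hM, h1⟩ := exists_layerPotential_le (a := a) (b := (n : ℝ) - 1) (by linarith)
    (by linarith) (by linarith) (by linarith) hD hh
  obtain ⟨Q, hQ, h2⟩ := exists_layerPotential_le (a := a) (b := (n : ℝ) - 1 + γ) (by linarith)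
    (by linarith) (by linarith) (by linarith) hD hh
  refine ⟨M, ENNReal.ofReal ((n : ℝ) - 1) * Q, hM, by finiteness, fun x => ?_, fun x z => ?_⟩
  · simpa only [layerPotential, he] using h1 x
  · unfold layerPotential
    calc ∫⁻ y, h y * ‖x - bdry y‖ₑ ^ (1 - (n : ℝ))
        ≤ ∫⁻ y, (h y * ‖z - bdry y‖ₑ ^ (1 - (n : ℝ)) + ENNReal.ofReal ((n : ℝ) - 1) *
            ‖x - z‖ₑ ^ γ * (h y * ‖x - bdry y‖ₑ ^ (-((n : ℝ) - 1 + γ)))) := by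
          refine lintegral_mono fun y => ?_
          have := enorm_rpow_neg_le_add (m := (n : ℝ) - 1) (by linarith) hγ0 hγ1.le
            (x - bdry y) (z - bdry y)
          rw [sub_sub_sub_cancel_right, ← he] at this
          calc _ ≤ h y * (‖z - bdry y‖ₑ ^ (1 - (n : ℝ)) + ENNReal.ofReal ((n : ℝ) - 1) *
                    ‖x - z‖ₑ ^ γ * ‖x - bdry y‖ₑ ^ (-((n : ℝ) - 1 + γ))) := by gcongr
            _ = _ := by ring
      _ = (∫⁻ y, h y * ‖z - bdry y‖ₑ ^ (1 - (n : ℝ))) + ENNReal.ofReal ((n : ℝ) - 1) *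
            ‖x - z‖ₑ ^ γ * ∫⁻ y, (h y * ‖x - bdry y‖ₑ ^ (-((n : ℝ) - 1 + γ))) := by
          rw [lintegral_add_left (by fun_prop), lintegral_const_mul _ (by fun_prop)]
      _ ≤ _ := by
          rw [mul_right_comm]
          gcongr
          exact h2 x

theorem memHolderSpace_toReal {F : Eucl (n + 1) → ℝ≥0∞} {M K : ℝ≥0∞} {γ : ℝ≥0} (hM : M < ∞)
    (hK : K < ∞) (hF : ∀ x, F x ≤ M) (hH : ∀ x z, F x ≤ F z + K * ‖x - z‖ₑ ^ (γ : ℝ))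
    (S : Set (Eucl (n + 1))) : MemHolderSpace γ S fun x => (F x).toReal := by
  refine ⟨⟨M.toReal, fun x _ => ?_⟩, K.toNNReal, fun x _ z _ => ?_⟩
  · rw [abs_of_nonneg ENNReal.toReal_nonneg]
    exact ENNReal.toReal_mono hM.ne (hF x)
  · have ht : ∀ x, F x ≠ ∞ := fun x => ((hF x).trans_lt hM).ne
    have hle : ∀ x z, (F x).toReal - (F z).toReal ≤ (K * ‖x - z‖ₑ ^ (γ : ℝ)).toReal := by
      intro x z
      have h0 : K * ‖x - z‖ₑ ^ (γ : ℝ) ≠ ∞ := by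
        have : ‖x - z‖ₑ ^ (γ : ℝ) ≠ ∞ := ENNReal.rpow_ne_top_of_nonneg γ.2 (by simp)
        finiteness
      rw [sub_le_iff_le_add', ← ENNReal.toReal_add (ht z) h0]
      exact ENNReal.toReal_mono (by simp [ht z, h0]) (hH x z)
    have h0 : K * ‖x - z‖ₑ ^ (γ : ℝ) ≠ ∞ := by
      have : ‖x - z‖ₑ ^ (γ : ℝ) ≠ ∞ := ENNReal.rpow_ne_top_of_nonneg γ.2 (by simp)
      finiteness
    rw [ENNReal.coe_toNNReal hK.ne, edist_dist, Real.dist_eq, edist_eq_enorm_sub]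
    refine ENNReal.ofReal_le_of_le_toReal (abs_sub_le_iff.2 ⟨hle x z, ?_⟩)
    rw [← enorm_neg (x - z), neg_sub]
    exact hle z x

/-! ### Newtonian and Green potentials -/

theorem continuous_fundSol : Continuous (fundSol (n := n)) := by
  unfold fundSol
  exact (ENNReal.continuous_const_mul ENNReal.ofReal_ne_top).comp
    (ENNReal.continuous_rpow_const.comp continuous_enorm)

theorem measurable_fundSol : Measurable (fundSol (n := n)) := continuous_fundSol.measurable

theorem newtonPotential_eq_of_ae_upper {μ : Measure (Eucl (n + 1))} (hsupp : μ.support ⊆ upper n)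
    (x : Eucl (n + 1)) : ∫⁻ y in upper n, fundSol (x - y) ∂μ = newtonPotential μ x := by
  rw [Measure.restrict_eq_self_of_ae_mem]
  · rfl
  · filter_upwards [Measure.support_mem_ae (μ := μ)] with y hy using hsupp hy

theorem greenPotential_eq {μ : Measure (Eucl (n + 1))} (hsupp : μ.support ⊆ upper n)
    (x : Eucl (n + 1)) :
    greenPotential μ x = newtonPotential μ x + newtonPotential μ (reflect x) := by
  have := measurable_fundSol (n := n)
  unfold greenPotential green
  rw [lintegral_add_left (by fun_prop), newtonPotential_eq_of_ae_upper hsupp,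
    newtonPotential_eq_of_ae_upper hsupp]

theorem measurable_newtonPotential (μ : Measure (Eucl (n + 1))) [SFinite μ] :
    Measurable (newtonPotential μ) := by
  have := measurable_fundSol (n := n)
  exact Measurable.lintegral_prod_right'
    (f := fun q : Eucl (n + 1) × Eucl (n + 1) => fundSol (q.1 - q.2)) (by fun_prop)

/-- Some ball of radius r carries mass, and its points lie within R+r of every x with |x| < R. -/
theorem exists_le_newtonPotential (hn : 2 ≤ n) {μ : Measure (Eucl (n + 1))} (hμ : μ ≠ 0) {R : ℝ}
    (hR : 0 < R) : ∃ A : ℝ≥0∞, A ≠ 0 ∧ ∀ x, ‖x‖ < R → A ≤ newtonPotential μ x := by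
  have hn' : (2 : ℝ) ≤ n := by exact_mod_cast hn
  obtain ⟨r, hr⟩ : ∃ r : ℕ, μ (Metric.ball 0 r) ≠ 0 := by
    by_contra! h
    apply hμ
    rw [← Measure.measure_univ_eq_zero, ← Metric.iUnion_ball_nat (0 : Eucl (n + 1))]
    exact measure_iUnion_null h
  set A₀ : ℝ≥0∞ := ENNReal.ofReal (1 / (((n : ℝ) - 1) * sphereArea n)) *
    ENNReal.ofReal (R + r) ^ (1 - (n : ℝ))
  have hA₀ : A₀ ≠ 0 := by
    have h1 : 0 < sphereArea n := sphereArea_pos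
    have h2 : (0 : ℝ) < (n : ℝ) - 1 := by linarith
    refine mul_ne_zero ?_ ?_
    · rw [Ne, ENNReal.ofReal_eq_zero, not_le]; positivity
    · rw [ENNReal.ofReal_rpow_of_pos (by positivity), Ne, ENNReal.ofReal_eq_zero, not_le]
      positivity
  refine ⟨A₀ * μ (Metric.ball 0 r), mul_ne_zero hA₀ hr, fun x hx => ?_⟩
  rw [← setLIntegral_const]
  refine (setLIntegral_mono' Metric.isOpen_ball.measurableSet fun y hy => ?_).trans
    (setLIntegral_le_lintegral _ _)
  unfold fundSol
  rw [mem_ball_zero_iff] at hy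
  refine mul_le_mul_right ?_ _
  rw [show (1 - (n : ℝ)) = -((n : ℝ) - 1) by ring]
  refine ENNReal.rpow_neg_le_rpow_neg (by linarith) ?_
  rw [← ofReal_norm]
  exact ENNReal.ofReal_le_ofReal (by linarith [norm_sub_le x y])

/-- The potential is lower semicontinuous by Fatou, and a set of full measure is dense. This
transfers the assumed decay to the boundary, which is a null set. -/
theorem newtonPotential_le_of_ae {μ : Measure (Eucl (n + 1))} {g : Eucl (n + 1) → ℝ≥0∞}
    (hg : Continuous g) (h : ∀ᵐ x, newtonPotential μ x ≤ g x) (x : Eucl (n + 1)) :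
    newtonPotential μ x ≤ g x := by
  have hms := measurable_fundSol (n := n)
  obtain ⟨z, hz, hzx⟩ := mem_closure_iff_seq_limit.1 (Measure.dense_of_ae h x)
  calc newtonPotential μ x = ∫⁻ y, liminf (fun j => fundSol (z j - y)) atTop ∂μ := by
        refine lintegral_congr fun y => ?_
        have : Tendsto (fun j => fundSol (z j - y)) atTop (𝓝 (fundSol (x - y))) :=
          (continuous_fundSol.tendsto _).comp (hzx.sub_const y)
        exact this.liminf_eq.symm
    _ ≤ liminf (fun j => newtonPotential μ (z j)) atTop :=
        lintegral_liminf_le fun j => by fun_prop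
    _ ≤ liminf (fun j => g (z j)) atTop := liminf_le_liminf (Eventually.of_forall hz)
    _ = g x := ((hg.tendsto x).comp hzx).liminf_eq

/-- If the δ-ball about x misses the support and |z-x| < δ/2, then |x-y| ≤ 2|z-y| on the support.
Hence a multiple of Φ(x-y), integrable by finiteness at x, dominates. -/
theorem tendsto_newtonPotential_of_notMem_support (hn : 2 ≤ n) {μ : Measure (Eucl (n + 1))}
    {x : Eucl (n + 1)} (hx : x ∉ μ.support) (hfin : newtonPotential μ x < ∞) :
    Tendsto (newtonPotential μ) (𝓝 x) (𝓝 (newtonPotential μ x)) := by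
  have hn' : (2 : ℝ) ≤ n := by exact_mod_cast hn
  have hms := measurable_fundSol (n := n)
  have he : (1 - (n : ℝ)) = -((n : ℝ) - 1) := by ring
  obtain ⟨δ, hδ, hball⟩ := Metric.mem_nhds_iff.1 (Measure.isOpen_compl_support.mem_nhds hx)
  refine tendsto_lintegral_filter_of_dominated_convergence
    (fun y => 2 ^ ((n : ℝ) - 1) * fundSol (x - y)) (Eventually.of_forall fun z => by fun_prop)
    ?_ ?_ ?_
  · filter_upwards [Metric.ball_mem_nhds x (half_pos hδ)] with z hz
    filter_upwards [Measure.support_mem_ae (μ := μ)] with y hy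
    have hy' : δ ≤ dist y x := by
      by_contra! h
      exact hball h hy
    have h1 : dist y x ≤ 2 * dist z y := by
      have h2 := dist_triangle y z x
      have h3 : dist z x < δ / 2 := hz
      rw [dist_comm y z] at h2
      linarith
    unfold fundSol
    rw [mul_left_comm]
    refine mul_le_mul_right ?_ _
    rw [he]
    refine rpow_neg_le_of_half_le (by linarith) two_ne_zero ENNReal.ofNat_ne_top ?_
    rw [← ofReal_norm, ← ofReal_norm, two_mul, ← ENNReal.ofReal_add (norm_nonneg _) (norm_nonneg _),
      ← dist_eq_norm, ← dist_eq_norm, dist_comm x, ← two_mul]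
    exact ENNReal.ofReal_le_ofReal h1
  · rw [lintegral_const_mul _ (by fun_prop)]
    exact ENNReal.mul_ne_top (ENNReal.rpow_ne_top_of_nonneg (by linarith) (by simp)) hfin.ne
  · exact Eventually.of_forall fun y =>
      (continuous_fundSol.tendsto _).comp (tendsto_id.sub_const y)

theorem tendsto_greenPotential_bdry (hn : 2 ≤ n) {μ : Measure (Eucl (n + 1))}
    (hsupp : μ.support ⊆ upper n) (hfin : ∀ x, newtonPotential μ x < ∞) (x' : Eucl n) :
    Tendsto (greenPotential μ) (𝓝 (bdry x')) (𝓝 (greenPotential μ (bdry x'))) := by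
  have h := tendsto_newtonPotential_of_notMem_support hn
    (fun h => bdry_notMem_upper x' (hsupp h)) (hfin (bdry x'))
  have hr : Tendsto (reflect (n := n)) (𝓝 (bdry x')) (𝓝 (bdry x')) := by
    simpa using (continuous_reflect (n := n)).tendsto (bdry x')
  rw [show greenPotential μ = fun x => newtonPotential μ x + newtonPotential μ (reflect x) from
    funext fun x => greenPotential_eq hsupp x]
  simp only [reflect_bdry]
  exact h.add (h.comp hr)

/-! ### Divergence at infinity and lower bounds by the boundary mass -/

theorem volume_ball_eq {R : ℝ} (hR : 0 < R) :
    volume (Metric.ball (0 : Eucl n) R) =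
      ENNReal.ofReal R ^ (n : ℝ) * volume (Metric.ball (0 : Eucl n) 1) := by
  rw [Measure.addHaar_ball_of_pos _ _ hR, finrank_euclideanSpace, Fintype.card_fin,
    ENNReal.rpow_natCast, ENNReal.ofReal_pow hR.le]

theorem rpow_mul_volume_ball_le {f : Eucl n → ℝ≥0∞} {a : ℝ≥0∞} {p R : ℝ} (hp : 0 ≤ p)
    (h : ∀ᵐ y, ‖y‖ < R → a ≤ f y) :
    a ^ p * volume (Metric.ball (0 : Eucl n) R) ≤ ∫⁻ y in Metric.ball 0 R, f y ^ p := by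
  rw [← setLIntegral_const]
  refine setLIntegral_mono_ae' Metric.isOpen_ball.measurableSet ?_
  filter_upwards [h] with y hy hyR
  exact ENNReal.rpow_le_rpow (hy (mem_ball_zero_iff.1 hyR)) hp

theorem le_volume_annulus (hn : 1 ≤ n) {R : ℝ} (hR : 0 < R) :
    ENNReal.ofReal R ^ (n : ℝ) * volume (Metric.ball (0 : Eucl n) 1) ≤
      volume (Metric.ball (0 : Eucl n) (2 * R) \ Metric.ball 0 R) := by
  rw [measure_sdiff (Metric.ball_subset_ball (by linarith))
    Metric.isOpen_ball.measurableSet.nullMeasurableSet measure_ball_lt_top.ne]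
  refine ENNReal.le_sub_of_add_le_right measure_ball_lt_top.ne ?_
  rw [← volume_ball_eq hR, volume_ball_eq (n := n) (R := 2 * R) (by linarith), volume_ball_eq hR,
    ← two_mul, ← mul_assoc, ENNReal.ofReal_mul zero_le_two,
    ENNReal.mul_rpow_of_nonneg _ _ (Nat.cast_nonneg n), ENNReal.ofReal_ofNat]
  gcongr
  calc (2 : ℝ≥0∞) = 2 ^ (1 : ℝ) := (ENNReal.rpow_one _).symm
    _ ≤ 2 ^ (n : ℝ) := ENNReal.rpow_le_rpow_of_exponent_le (by norm_num) (by exact_mod_cast hn)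

/-- Every dyadic annulus contributes at least the same positive amount, c times the volume of the
unit ball. -/
theorem lintegral_eq_top_of_le_rpow_neg_dim (hn : 1 ≤ n) {g : Eucl n → ℝ≥0∞} {c : ℝ≥0∞} (hc : c ≠ 0)
    {R₀ : ℝ} (hR₀ : 0 < R₀)
    (h : ∀ R ≥ R₀, ∀ᵐ y : Eucl n, R ≤ ‖y‖ → ‖y‖ < 2 * R → c * ENNReal.ofReal R ^ (-(n : ℝ)) ≤ g y) :
    ∫⁻ y, g y = ∞ := by
  set V := volume (Metric.ball (0 : Eucl n) 1)
  have hV : V ≠ 0 := (Metric.measure_ball_pos _ _ one_pos).ne'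
  have step : ∀ R ≥ R₀, c * V ≤ ∫⁻ y in Metric.ball (0 : Eucl n) (2 * R) \ Metric.ball 0 R, g y := by
    intro R hR
    have hRp : 0 < R := hR₀.trans_le hR
    have hρ : ENNReal.ofReal R ≠ 0 := by simpa using hRp
    calc c * V = c * ENNReal.ofReal R ^ (-(n : ℝ)) * (ENNReal.ofReal R ^ (n : ℝ) * V) := by
          rw [mul_assoc, ← mul_assoc (ENNReal.ofReal R ^ (-(n : ℝ))),
            ← ENNReal.rpow_add _ _ hρ ENNReal.ofReal_ne_top]
          simp
      _ ≤ c * ENNReal.ofReal R ^ (-(n : ℝ)) *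
            volume (Metric.ball (0 : Eucl n) (2 * R) \ Metric.ball 0 R) := by
          gcongr
          exact le_volume_annulus hn hRp
      _ ≤ _ := by
          rw [← setLIntegral_const]
          refine setLIntegral_mono_ae'
            (Metric.isOpen_ball.measurableSet.diff Metric.isOpen_ball.measurableSet) ?_
          filter_upwards [h R hR] with y hy hyR
          simp only [Set.mem_sdiff, mem_ball_zero_iff, not_lt] at hyR
          exact hy hyR.2 hyR.1
  have ind : ∀ j : ℕ, j * (c * V) ≤ ∫⁻ y in Metric.ball (0 : Eucl n) (2 ^ j * R₀), g y := by
    intro j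
    induction j with
    | zero => simp
    | succ j ih =>
      have h1 : R₀ ≤ 2 ^ j * R₀ := le_mul_of_one_le_left hR₀.le (one_le_pow₀ (by norm_num))
      have h2 : Metric.ball (0 : Eucl n) (2 ^ (j + 1) * R₀) =
          Metric.ball 0 (2 ^ j * R₀) ∪
            (Metric.ball 0 (2 * (2 ^ j * R₀)) \ Metric.ball 0 (2 ^ j * R₀)) := by
        rw [union_sdiff_cancel (Metric.ball_subset_ball (by linarith))]
        congr 1; ring
      rw [h2, lintegral_union (Metric.isOpen_ball.measurableSet.diff Metric.isOpen_ball.measurableSet)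
        disjoint_sdiff_right]
      push_cast
      rw [add_mul, one_mul]
      exact add_le_add ih (step _ h1)
  refine ENNReal.eq_top_of_forall_nnreal_le fun r => ?_
  obtain ⟨j, hj⟩ := ENNReal.exists_nat_mul_gt (mul_ne_zero hc hV) (ENNReal.coe_ne_top (r := r))
  exact hj.le.trans ((ind j).trans (setLIntegral_le_lintegral _ _))

/-- The mass `∫_{|y| < R} u(y, 0)^p dy` of the boundary values. -/
noncomputable def bdryMass (p : ℝ) (u : Eucl (n + 1) → ℝ) (R : ℝ) : ℝ≥0∞ :=
  ∫⁻ y in Metric.ball (0 : Eucl n) R, ENNReal.ofReal (u (bdry y)) ^ p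

theorem bdryMass_mono (p : ℝ) (u : Eucl (n + 1) → ℝ) : Monotone (bdryMass p u) := fun _ _ h =>
  lintegral_mono_set (Metric.ball_subset_ball h)

theorem rpow_mul_bdryMass_le_nonlocalTerm {k p : ℝ} (hk : 0 ≤ k) (u : Eucl (n + 1) → ℝ) {R S : ℝ}
    {x : Eucl n} (hx : ‖x‖ + R ≤ S) :
    ENNReal.ofReal S ^ (-k) * bdryMass p u R ≤ nonlocalTerm k p u x := by
  have hS : (ENNReal.ofReal S ^ (-k) ≠ ∞) ∨ R ≤ 0 := by
    by_cases h : 0 < S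
    · left; rw [ENNReal.ofReal_rpow_of_pos h]; exact ENNReal.ofReal_ne_top
    · right; linarith [norm_nonneg x]
  rcases hS with hS | hR
  · unfold bdryMass nonlocalTerm
    rw [← lintegral_const_mul' _ _ hS]
    refine (setLIntegral_mono' Metric.isOpen_ball.measurableSet fun y hy => ?_).trans
      (setLIntegral_le_lintegral _ _)
    rw [mul_comm]
    refine mul_le_mul_right (ENNReal.rpow_neg_le_rpow_neg hk ?_) _
    rw [← ofReal_norm]
    exact ENNReal.ofReal_le_ofReal (by linarith [norm_sub_le x y, mem_ball_zero_iff.1 hy])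
  · simp [bdryMass, Metric.ball_eq_empty.2 hR]

/-- Restrict both integrations to |y|, |z| < R, where all distances are at most 2R. The powers of R
are -k and 1-n from the kernels and n from the volume. -/
theorem mul_bdryMass_le_liftedTerm (hn : 1 ≤ n) {k p : ℝ} (hk : 0 ≤ k) (u : Eucl (n + 1) → ℝ) {R : ℝ}
    (hR : 0 < R) {x : Eucl (n + 1)} (hx : ‖x‖ < R) :
    2 ^ (1 - (n : ℝ) - k) * volume (Metric.ball (0 : Eucl n) 1) * ENNReal.ofReal R ^ (1 - k) *
      bdryMass p u R ≤ liftedTerm k p u x := by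
  have hn' : (1 : ℝ) ≤ n := by exact_mod_cast hn
  have hρ : ENNReal.ofReal R ≠ 0 := by simpa using hR
  have hρt : ENNReal.ofReal R ≠ ∞ := ENNReal.ofReal_ne_top
  have h2 : ENNReal.ofReal (2 * R) = 2 * ENNReal.ofReal R := by
    rw [ENNReal.ofReal_mul zero_le_two, ENNReal.ofReal_ofNat]
  calc _ = ENNReal.ofReal (2 * R) ^ (-k) * bdryMass p u R * ENNReal.ofReal (2 * R) ^ (1 - (n : ℝ)) *
        volume (Metric.ball (0 : Eucl n) R) := by
        rw [h2, ENNReal.mul_rpow_of_ne_top ENNReal.ofNat_ne_top hρt,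
          ENNReal.mul_rpow_of_ne_top ENNReal.ofNat_ne_top hρt, volume_ball_eq hR,
          show 1 - (n : ℝ) - k = -k + (1 - n) by ring,
          ENNReal.rpow_add _ _ two_ne_zero ENNReal.ofNat_ne_top,
          show 1 - k = -k + (1 - n) + n by ring, ENNReal.rpow_add _ _ hρ hρt,
          ENNReal.rpow_add _ _ hρ hρt]
        ring
    _ ≤ ∫⁻ y in Metric.ball (0 : Eucl n) R, nonlocalTerm k p u y * ‖x - bdry y‖ₑ ^ (1 - (n : ℝ)) := by
        rw [← setLIntegral_const]
        refine setLIntegral_mono' Metric.isOpen_ball.measurableSet fun y hy => ?_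
        rw [mem_ball_zero_iff] at hy
        refine mul_le_mul' (rpow_mul_bdryMass_le_nonlocalTerm hk u (by linarith)) ?_
        rw [show (1 - (n : ℝ)) = -((n : ℝ) - 1) by ring]
        refine ENNReal.rpow_neg_le_rpow_neg (by linarith) ?_
        rw [← ofReal_norm]
        refine ENNReal.ofReal_le_ofReal ?_
        have := norm_sub_le x (bdry y)
        rw [norm_bdry] at this
        linarith
    _ ≤ _ := setLIntegral_le_lintegral _ _

/-- A property valid a.e. holds at points of the open half space arbitrarily close to the boundary
point, and the inequality survives the limit there. Thus the integral equation is never needed on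
the boundary itself. -/
theorem ae_le_bdry_of_ae_le {u : Eucl (n + 1) → ℝ}
    (hu : ∀ᵐ x' : Eucl n, Tendsto u (𝓝[upper n] (bdry x')) (𝓝 (u (bdry x')))) {R : ℝ} {A : ℝ≥0∞}
    (h : ∀ᵐ x ∂(volume.restrict (upper n)), ‖x‖ < R → A ≤ ENNReal.ofReal (u x)) :
    ∀ᵐ x' : Eucl n, ‖x'‖ < R → A ≤ ENNReal.ofReal (u (bdry x')) := by
  filter_upwards [hu] with x' hx' hxR
  refine ge_of_tendsto_of_frequently (ENNReal.tendsto_ofReal hx') ?_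
  rw [(nhdsWithin_basis_open _ _).frequently_iff]
  rintro U ⟨hxU, hU⟩
  have hW : IsOpen (U ∩ Metric.ball 0 R ∩ upper n) := (hU.inter Metric.isOpen_ball).inter isOpen_upper
  have hne : (U ∩ Metric.ball 0 R ∩ upper n).Nonempty :=
    mem_closure_iff.1 (bdry_mem_closure_upper x') _ (hU.inter Metric.isOpen_ball)
      ⟨hxU, by simpa using hxR⟩
  rw [ae_restrict_iff' isOpen_upper.measurableSet] at h
  obtain ⟨z, hz, hzA⟩ := (Measure.dense_of_ae h).inter_open_nonempty _ hW hne
  exact ⟨z, ⟨hz.1.1, hz.2⟩, hzA hz.2 (by simpa using hz.1.2)⟩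

end HalfSpace

/-! ### Nonexistence -/

theorem Real.not_forall_mul_rpow_le {c e K R₀ : ℝ} (hc : 0 < c) (he : 0 < e)
    (h : ∀ R ≥ R₀, c * R ^ e ≤ K) : False := by
  have h1 := (tendsto_rpow_atTop he).const_mul_atTop hc
  obtain ⟨R, hR, hR'⟩ := ((h1.eventually_gt_atTop K).and (eventually_ge_atTop R₀)).exists
  exact absurd (h R hR') (not_le.2 hR)

namespace HalfSpace

variable {n : ℕ}

/-- A growth rate for the mass of the balls of radius `R` that forces nonexistence below the
critical exponent. -/
theorem false_of_mass_growth {M : ℝ → ℝ} {c p β d L R₀ : ℝ} (hc : 0 < c) (hβd : β < d)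
    (hpβ : β * p < d) (hM1 : 0 < M 1) (hmono : Monotone M)
    (hgrow : ∀ R ≥ 1, c * R ^ d * (R ^ (-β) * M R) ^ p ≤ M R)
    (hbdd : ∀ R ≥ R₀, R ^ (-β) * M R ≤ L) : False := by
  -- With T = R^(-β) M(R), growth reads c R^(d-β) T^p ≤ T. For p ≤ 1 this contradicts the upper
  -- bound on T; for p > 1 divide by M(R) and use M(R) ≥ M(1) > 0 instead.
  rcases le_or_gt p 1 with h1 | h1
  · refine Real.not_forall_mul_rpow_le (c := c) (e := d - β) (K := L ^ (1 - p)) (R₀ := max 1 R₀)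
      hc (by linarith) fun R hR => ?_
    have hR1 : 1 ≤ R := (le_max_left _ _).trans hR
    have hR0 : 0 < R := by linarith
    have hMR : 0 < M R := hM1.trans_le (hmono hR1)
    have hT : 0 < R ^ (-β) * M R := by positivity
    refine le_trans ?_ (Real.rpow_le_rpow hT.le (hbdd R ((le_max_right _ _).trans hR))
      (by linarith))
    have h2 := mul_le_mul_of_nonneg_left (hgrow R hR1) (Real.rpow_pos_of_pos hR0 (-β)).le
    set T := R ^ (-β) * M R
    rw [Real.rpow_sub hT, Real.rpow_one, le_div_iff₀ (Real.rpow_pos_of_pos hT _)]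
    calc c * R ^ (d - β) * T ^ p = R ^ (-β) * (c * R ^ d * T ^ p) := by
          rw [sub_eq_neg_add, Real.rpow_add hR0]; ring
      _ ≤ T := h2
  · refine Real.not_forall_mul_rpow_le (c := c * M 1 ^ (p - 1)) (e := d - β * p) (K := 1) (R₀ := 1)
      (by positivity) (by linarith) fun R hR1 => ?_
    have hR0 : 0 < R := by linarith
    have hMR : 0 < M R := hM1.trans_le (hmono hR1)
    have h2 := hgrow R hR1
    rw [Real.mul_rpow (by positivity) hMR.le, ← Real.rpow_mul hR0.le] at h2
    have h3 : M R ^ p = M R ^ (p - 1) * M R := by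
      rw [← Real.rpow_add_one hMR.ne']; congr 1; ring
    have h4 : R ^ (d - β * p) = R ^ d * R ^ (-β * p) := by
      rw [← Real.rpow_add hR0]; congr 1; ring
    have h5 : (c * R ^ (d - β * p) * M R ^ (p - 1)) * M R ≤ 1 * M R := by
      rw [h4, one_mul]
      refine le_trans (le_of_eq ?_) h2
      rw [h3]; ring
    have h6 := le_of_mul_le_mul_right h5 hMR
    calc c * M 1 ^ (p - 1) * R ^ (d - β * p) ≤ c * M R ^ (p - 1) * R ^ (d - β * p) := by
          have := Real.rpow_le_rpow hM1.le (hmono hR1) (by linarith : 0 ≤ p - 1)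
          gcongr
      _ ≤ 1 := by linarith

section

variable {k p lam : ℝ} {μ : Measure (Eucl (n + 1))} {u : Eucl (n + 1) → ℝ}

theorem IsPositiveSolution.exists_le_bdry (hn : 2 ≤ n) (hμ : μ ≠ 0) (hsupp : μ.support ⊆ upper n)
    (hu : IsPositiveSolution k p lam μ u) {R : ℝ} (hR : 0 < R) :
    ∃ A : ℝ≥0∞, A ≠ 0 ∧ ∀ᵐ x' : Eucl n, ‖x'‖ < R → A ≤ ENNReal.ofReal (u (bdry x')) := by
  obtain ⟨A, hA, h⟩ := exists_le_newtonPotential hn hμ hR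
  refine ⟨A, hA, ae_le_bdry_of_ae_le hu.boundary_limit ?_⟩
  filter_upwards [hu.equation] with x hx hxR
  rw [hx, greenPotential_eq hsupp]
  exact (h x hxR).trans (le_self_add.trans le_self_add)

theorem IsPositiveSolution.bdryMass_ne_zero (hn : 2 ≤ n) (hp : 0 < p) (hμ : μ ≠ 0)
    (hsupp : μ.support ⊆ upper n) (hu : IsPositiveSolution k p lam μ u) :
    bdryMass p u 1 ≠ 0 := by
  obtain ⟨A, hA, h⟩ := hu.exists_le_bdry hn hμ hsupp one_pos
  have h1 := rpow_mul_volume_ball_le hp.le h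
  refine fun h0 => ?_
  rw [show ∫⁻ y in Metric.ball (0 : Eucl n) 1, ENNReal.ofReal (u (bdry y)) ^ p = 0 from h0,
    nonpos_iff_eq_zero, mul_eq_zero, ENNReal.rpow_eq_zero_iff] at h1
  rcases h1 with (⟨h1, -⟩ | ⟨-, h1⟩) | h1
  · exact hA h1
  · linarith
  · exact (Metric.measure_ball_pos _ _ one_pos).ne' h1

theorem IsPositiveSolution.bdryMass_ne_top (hk : 0 ≤ k)
    (hu : IsPositiveSolution k p lam μ u) (R : ℝ) : bdryMass p u R ≠ ∞ := by
  obtain ⟨x, hx⟩ := hu.nonlocal_finite.exists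
  have hS : 0 < ‖x‖ + |R| + 1 := by positivity
  have h := rpow_mul_bdryMass_le_nonlocalTerm (p := p) hk u (x := x) (R := R) (S := ‖x‖ + |R| + 1)
    (by linarith [le_abs_self R])
  intro h0
  rw [h0, ENNReal.mul_top] at h
  · exact absurd hx (not_lt.2 h)
  · rw [ENNReal.ofReal_rpow_of_pos hS, Ne, ENNReal.ofReal_eq_zero, not_le]
    positivity

theorem IsPositiveSolution.exists_liftedTerm_lt_top (hu : IsPositiveSolution k p lam μ u) :
    ∃ x, liftedTerm k p u x < ∞ := by
  have hne : (ae (volume.restrict (upper n))).NeBot := by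
    rw [ae_neBot, Ne, Measure.restrict_eq_zero]
    refine (isOpen_upper.measure_pos _ ?_).ne'
    exact closure_nonempty_iff.1 ⟨_, bdry_mem_closure_upper 0⟩
  exact hu.lifted_finite.exists

theorem IsPositiveSolution.exists_mul_bdryMass_le_bdry (hn : 2 ≤ n) (hk : 0 ≤ k) (hlam : 0 < lam)
    (hu : IsPositiveSolution k p lam μ u) :
    ∃ c : ℝ≥0∞, c ≠ 0 ∧ c ≠ ∞ ∧ ∀ R : ℝ, 0 < R → ∀ᵐ x' : Eucl n, ‖x'‖ < R →
      c * (ENNReal.ofReal R ^ (1 - k) * bdryMass p u R) ≤ ENNReal.ofReal (u (bdry x')) := by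
  have hn' : (2 : ℝ) ≤ n := by exact_mod_cast hn
  set V := volume (Metric.ball (0 : Eucl n) 1)
  have hV : V ≠ 0 := (Metric.measure_ball_pos _ _ one_pos).ne'
  have hVt : V ≠ ∞ := measure_ball_lt_top.ne
  set Λ := ENNReal.ofReal (2 * lam / (((n : ℝ) - 1) * sphereArea n))
  have hΛ : Λ ≠ 0 := by
    have h1 : 0 < sphereArea n := sphereArea_pos
    have h2 : (0 : ℝ) < (n : ℝ) - 1 := by linarith
    rw [Ne, ENNReal.ofReal_eq_zero, not_le]; positivity
  have h2 : (2 : ℝ≥0∞) ^ (1 - (n : ℝ) - k) ≠ 0 := by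
    simp [ENNReal.rpow_eq_zero_iff]
  have h2t : (2 : ℝ≥0∞) ^ (1 - (n : ℝ) - k) ≠ ∞ :=
    ENNReal.rpow_ne_top_of_ne_zero two_ne_zero ENNReal.ofNat_ne_top
  refine ⟨Λ * (2 ^ (1 - (n : ℝ) - k) * V), mul_ne_zero hΛ (mul_ne_zero h2 hV),
    ENNReal.mul_ne_top ENNReal.ofReal_ne_top (ENNReal.mul_ne_top h2t hVt), fun R hR => ?_⟩
  refine ae_le_bdry_of_ae_le hu.boundary_limit ?_
  filter_upwards [hu.equation] with x hx hxR
  rw [hx]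
  refine le_trans ?_ le_add_self
  rw [mul_assoc]
  refine mul_le_mul_right ?_ _
  rw [← mul_assoc]
  exact mul_bdryMass_le_liftedTerm (by omega) hk u hR hxR

/-- The mass in the unit ball alone makes the outer integrand at least of order |y|^(1-n-k) at
infinity, and 1-n-k ≥ -n. -/
theorem not_isPositiveSolution_of_le_one (hn : 2 ≤ n) (hk0 : 0 < k) (hk : k ≤ 1) (hp : 0 < p)
    (hμ : μ ≠ 0) (hsupp : μ.support ⊆ upper n) : ¬ IsPositiveSolution k p lam μ u := by
  intro hu
  have hn' : (2 : ℝ) ≤ n := by exact_mod_cast hn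
  obtain ⟨x, hx⟩ := hu.exists_liftedTerm_lt_top
  refine hx.ne (lintegral_eq_top_of_le_rpow_neg_dim (by omega) (R₀ := max 1 ‖x‖)
    (c := 3 ^ (1 - (n : ℝ) - k) * bdryMass p u 1) ?_ (by positivity) ?_)
  · refine mul_ne_zero ?_ (hu.bdryMass_ne_zero hn hp hμ hsupp)
    simp [ENNReal.rpow_eq_zero_iff]
  · refine fun R hR => Eventually.of_forall fun y hy1 hy2 => ?_
    have hR1 : 1 ≤ R := (le_max_left _ _).trans hR
    have hRx : ‖x‖ ≤ R := (le_max_right _ _).trans hR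
    have hρ1 : 1 ≤ ENNReal.ofReal R := by simpa using hR1
    have hρ : ENNReal.ofReal R ≠ 0 := (zero_lt_one.trans_le hρ1).ne'
    have hρt : ENNReal.ofReal R ≠ ∞ := ENNReal.ofReal_ne_top
    have h3 : ENNReal.ofReal (3 * R) = 3 * ENNReal.ofReal R := by
      rw [ENNReal.ofReal_mul (by norm_num), ENNReal.ofReal_ofNat]
    calc 3 ^ (1 - (n : ℝ) - k) * bdryMass p u 1 * ENNReal.ofReal R ^ (-(n : ℝ))
        ≤ 3 ^ (1 - (n : ℝ) - k) * bdryMass p u 1 * ENNReal.ofReal R ^ (1 - (n : ℝ) - k) := by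
          refine mul_le_mul_right (ENNReal.rpow_le_rpow_of_exponent_le hρ1 ?_) _
          linarith
      _ = ENNReal.ofReal (3 * R) ^ (-k) * bdryMass p u 1 *
            ENNReal.ofReal (3 * R) ^ (1 - (n : ℝ)) := by
          rw [mul_right_comm, mul_right_comm _ _ (ENNReal.ofReal (3 * R) ^ _),
            ← ENNReal.mul_rpow_of_ne_top ENNReal.ofNat_ne_top hρt, ← h3,
            ← ENNReal.rpow_add _ _ (by rw [h3]; simpa using by linarith) ENNReal.ofReal_ne_top]
          congr 2; ring
      _ ≤ nonlocalTerm k p u y * ‖x - bdry y‖ₑ ^ (1 - (n : ℝ)) := by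
          refine mul_le_mul' (rpow_mul_bdryMass_le_nonlocalTerm hk0.le u (by linarith)) ?_
          rw [show (1 - (n : ℝ)) = -((n : ℝ) - 1) by ring]
          refine ENNReal.rpow_neg_le_rpow_neg (by linarith) ?_
          rw [← ofReal_norm]
          refine ENNReal.ofReal_le_ofReal ?_
          have := norm_sub_le x (bdry y)
          rw [norm_bdry] at this
          linarith

theorem not_isPositiveSolution_of_lt (hn : 2 ≤ n) (hk1 : 1 < k) (hkn : k < n) (hp : 0 < p)
    (hpk : p < n / (k - 1)) (hlam : 0 < lam) (hμ : μ ≠ 0) (hsupp : μ.support ⊆ upper n) :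
    ¬ IsPositiveSolution k p lam μ u := by
  intro hu
  have hk0 : 0 ≤ k := by linarith
  obtain ⟨c, hc, hct, h⟩ := hu.exists_mul_bdryMass_le_bdry hn hk0 hlam
  obtain ⟨x, hx⟩ := hu.exists_liftedTerm_lt_top
  have hm := hu.bdryMass_ne_top hk0
  set V := volume (Metric.ball (0 : Eucl n) 1) with hV_def
  have hV : 0 < V.toReal := ENNReal.toReal_pos (Metric.measure_ball_pos _ _ one_pos).ne'
    measure_ball_lt_top.ne
  have hc' : 0 < c.toReal := ENNReal.toReal_pos hc hct
  set c₀ := (2 : ℝ≥0∞) ^ (1 - (n : ℝ) - k) * V with hc0_def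
  have hc₀ : 0 < c₀.toReal := by
    rw [ENNReal.toReal_mul, ← ENNReal.toReal_rpow]
    simp only [ENNReal.toReal_ofNat]
    positivity
  refine false_of_mass_growth (M := fun R => (bdryMass p u R).toReal) (c := c.toReal ^ p * V.toReal)
    (p := p) (β := k - 1) (d := n) (L := (liftedTerm k p u x).toReal / c₀.toReal) (R₀ := ‖x‖ + 1)
    (by positivity) (by linarith) ?_ ?_ ?_ ?_ ?_
  · rw [lt_div_iff₀ (by linarith)] at hpk
    linarith
  · exact ENNReal.toReal_pos (hu.bdryMass_ne_zero hn hp hμ hsupp) (hm 1)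
  · exact fun R S hRS => ENNReal.toReal_mono (hm S) (bdryMass_mono p u hRS)
  · intro R hR
    have hR0 : 0 < R := by linarith
    have h1 := ENNReal.toReal_mono (hm R) (rpow_mul_volume_ball_le hp.le (h R hR0))
    rw [volume_ball_eq hR0, ← hV_def] at h1
    simp only [ENNReal.toReal_mul, ← ENNReal.toReal_rpow, ENNReal.toReal_ofReal hR0.le] at h1
    rw [Real.mul_rpow (by positivity) (by positivity)] at h1
    rw [neg_sub]
    refine le_trans (le_of_eq ?_) h1
    ring
  · intro R hR
    have hR0 : 0 < R := by linarith [norm_nonneg x]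
    have h1 := ENNReal.toReal_mono hx.ne
      (mul_bdryMass_le_liftedTerm (by omega) hk0 u hR0 (x := x) (by linarith))
    rw [← hV_def, ← hc0_def, ENNReal.toReal_mul, ENNReal.toReal_mul, ← ENNReal.toReal_rpow,
      ENNReal.toReal_ofReal hR0.le] at h1
    rw [le_div_iff₀ hc₀, neg_sub]
    linarith

/-- The lower bound R^(1-k) m(1) for u(·,0) has p-th power of order R^(-n), since (1-k)p = -n, and
so is not integrable. -/
theorem not_isPositiveSolution_of_eq (hn : 2 ≤ n) (hk1 : 1 < k) (hp : 0 < p)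
    (hpk : p = n / (k - 1)) (hlam : 0 < lam) (hμ : μ ≠ 0) (hsupp : μ.support ⊆ upper n)
    (hL : MemLp (fun x' : Eucl n => u (bdry x')) (ENNReal.ofReal p) volume) :
    ¬ IsPositiveSolution k p lam μ u := by
  intro hu
  have hk0 : 0 ≤ k := by linarith
  obtain ⟨c, hc, hct, h⟩ := hu.exists_mul_bdryMass_le_bdry hn hk0 hlam
  have hm := hu.bdryMass_ne_top hk0 1
  have hm0 := hu.bdryMass_ne_zero hn hp hμ hsupp
  have h1 := lintegral_rpow_enorm_lt_top_of_eLpNorm_lt_top (by simpa using hp)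
    ENNReal.ofReal_ne_top hL.2
  rw [ENNReal.toReal_ofReal hp.le] at h1
  set c₁ := c * bdryMass p u 1
  have hc₁ : c₁ ≠ 0 := mul_ne_zero hc hm0
  have hc₁t : c₁ ≠ ∞ := ENNReal.mul_ne_top hct hm
  have hkp : (1 - k) * p = -(n : ℝ) := by
    have : k - 1 ≠ 0 := by linarith
    rw [hpk]; field_simp; ring
  refine h1.ne (lintegral_eq_top_of_le_rpow_neg_dim (by omega) (R₀ := 1)
    (c := c₁ ^ p * 2 ^ (-(n : ℝ))) ?_ one_pos ?_)
  · refine mul_ne_zero ?_ ?_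
    · simp [ENNReal.rpow_eq_zero_iff, hc₁, hc₁t]
    · simp [ENNReal.rpow_eq_zero_iff]
  · intro R hR
    have hR0 : 0 < R := by linarith
    -- The radius 2R is taken so that the ball covers the whole annulus R ≤ |y| < 2R.
    filter_upwards [h (2 * R) (by linarith)] with y hy _ hyR
    calc c₁ ^ p * 2 ^ (-(n : ℝ)) * ENNReal.ofReal R ^ (-(n : ℝ))
        = (c * (ENNReal.ofReal (2 * R) ^ (1 - k) * bdryMass p u 1)) ^ p := by
          rw [show c * (ENNReal.ofReal (2 * R) ^ (1 - k) * bdryMass p u 1) =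
              c₁ * ENNReal.ofReal (2 * R) ^ (1 - k) by simp only [c₁]; ring,
            ENNReal.mul_rpow_of_nonneg c₁ _ hp.le, ← ENNReal.rpow_mul, hkp,
            ENNReal.ofReal_mul zero_le_two, ENNReal.ofReal_ofNat,
            ENNReal.mul_rpow_of_ne_top ENNReal.ofNat_ne_top ENNReal.ofReal_ne_top, mul_assoc]
      _ ≤ (c * (ENNReal.ofReal (2 * R) ^ (1 - k) * bdryMass p u (2 * R))) ^ p := by
          gcongr
          exact bdryMass_mono p u (by linarith)
      _ ≤ ‖u (bdry y)‖ₑ ^ p := by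
          gcongr
          exact (hy hyR).trans (Real.ofReal_le_enorm _)

end

/-! ### Existence by monotone iteration -/

/-- The Riesz type potential `∫ f(z) |y - z|^(-k) dz`. -/
noncomputable def rieszPotential (k : ℝ) (f : Eucl n → ℝ≥0∞) (y : Eucl n) : ℝ≥0∞ :=
  ∫⁻ z, f z * ‖y - z‖ₑ ^ (-k)

/-- The layer potential of the Riesz potential of `g^p`, as a function on the whole space. -/
noncomputable def compositePotential (k p : ℝ) (g : Eucl n → ℝ≥0∞) : Eucl (n + 1) → ℝ≥0∞ :=
  layerPotential (rieszPotential k fun z => g z ^ p)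

theorem measurable_rieszPotential {k : ℝ} {f : Eucl n → ℝ≥0∞} (hf : Measurable f) :
    Measurable (rieszPotential k f) :=
  Measurable.lintegral_prod_right' (f := fun q : Eucl n × Eucl n => f q.2 * ‖q.1 - q.2‖ₑ ^ (-k))
    (by fun_prop)

theorem measurable_compositePotential {k p : ℝ} {g : Eucl n → ℝ≥0∞} (hg : Measurable g) :
    Measurable (compositePotential k p g) :=
  measurable_layerPotential (measurable_rieszPotential (by fun_prop))

theorem compositePotential_mono {k p : ℝ} (hp : 0 ≤ p) {g₁ g₂ : Eucl n → ℝ≥0∞} (h : g₁ ≤ g₂) :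
    compositePotential k p g₁ ≤ compositePotential k p g₂ := fun _ =>
  lintegral_mono fun _ => mul_le_mul_left
    (lintegral_mono fun z => mul_le_mul_left (ENNReal.rpow_le_rpow (h z) hp) _) _

theorem compositePotential_const_mul {k p : ℝ} (hp : 0 ≤ p) (A : ℝ≥0∞) {g : Eucl n → ℝ≥0∞}
    (hg : Measurable g) (x : Eucl (n + 1)) :
    compositePotential k p (fun z => A * g z) x = A ^ p * compositePotential k p g x := by
  have hb := measurable_bdry (n := n)
  have hr : Measurable (rieszPotential k fun z => g z ^ p) :=
    measurable_rieszPotential (by fun_prop)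
  unfold compositePotential layerPotential
  rw [← lintegral_const_mul _ (by fun_prop)]
  refine lintegral_congr fun y => ?_
  rw [← mul_assoc]
  congr 1
  unfold rieszPotential
  rw [← lintegral_const_mul _ (by fun_prop)]
  refine lintegral_congr fun z => ?_
  simp only [ENNReal.mul_rpow_of_nonneg _ _ hp, mul_assoc]

/-- Monotone convergence for both integrals; the p-th power commutes with suprema as an order
isomorphism of `[0, ∞]`. -/
theorem iSup_compositePotential {k p : ℝ} (hp : 0 < p) {g : ℕ → Eucl n → ℝ≥0∞}
    (hg : ∀ j, Measurable (g j)) (hmono : Monotone g) (x : Eucl (n + 1)) :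
    compositePotential k p (fun z => ⨆ j, g j z) x = ⨆ j, compositePotential k p (g j) x := by
  have hb := measurable_bdry (n := n)
  have hr : ∀ j, Measurable (rieszPotential k fun z => g j z ^ p) := fun j =>
    measurable_rieszPotential (by have := hg j; fun_prop)
  have h1 : ∀ y, rieszPotential k (fun z => (⨆ j, g j z) ^ p) y =
      ⨆ j, rieszPotential k (fun z => g j z ^ p) y := by
    intro y
    unfold rieszPotential
    rw [← lintegral_iSup (f := fun j z => g j z ^ p * ‖y - z‖ₑ ^ (-k))
      (fun j => by have := hg j; fun_prop) fun i j hij z =>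
        mul_le_mul_left (ENNReal.rpow_le_rpow (hmono hij z) hp.le) _]
    refine lintegral_congr fun z => ?_
    rw [← ENNReal.iSup_mul]
    refine congrArg (· * _) ?_
    exact (ENNReal.orderIsoRpow p hp).map_iSup fun j => g j z
  unfold compositePotential layerPotential
  rw [← lintegral_iSup
    (f := fun j y => rieszPotential k (fun z => g j z ^ p) y * ‖x - bdry y‖ₑ ^ (1 - (n : ℝ)))
    (fun j => by have := hr j; fun_prop) fun i j hij y => mul_le_mul_left
      (lintegral_mono fun z => mul_le_mul_left (ENNReal.rpow_le_rpow (hmono hij z) hp.le) _) _]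
  refine lintegral_congr fun y => ?_
  rw [h1, ENNReal.iSup_mul]

/-- After Tonelli the two kernels compose to one of exponent (n-1)+k-n = k-1. Since (k-1)p > n,
integrating the p-th power of the weight against it gives back the decay of the weight itself. -/
theorem exists_compositePotential_weight_le (hn : 2 ≤ n) {k p : ℝ} (hk1 : 1 < k) (hkn : k < n)
    (hp : n < (k - 1) * p) :
    ∃ C : ℝ≥0∞, C < ∞ ∧ ∀ x : Eucl n,
      compositePotential k p (fun z => (1 + ‖z‖ₑ) ^ (-(k - 1))) (bdry x) ≤
        C * (1 + ‖x‖ₑ) ^ (-(k - 1)) := by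
  have hn' : (2 : ℝ) ≤ n := by exact_mod_cast hn
  obtain ⟨C₁, hC₁, h1⟩ := exists_lintegral_enorm_rpow_mul_enorm_rpow_le (d := n) (a := (n : ℝ) - 1)
    (b := k) (by linarith) (by linarith) (by linarith) hkn (by linarith)
  obtain ⟨C₂, hC₂, h2⟩ := exists_lintegral_weight_mul_enorm_rpow_le_weight (d := n)
    (s := (k - 1) * p) (b := k - 1) hp (by linarith) (by linarith)
  refine ⟨C₁ * C₂, by finiteness, fun x => ?_⟩
  calc compositePotential k p (fun z => (1 + ‖z‖ₑ) ^ (-(k - 1))) (bdry x)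
      = ∫⁻ y, ∫⁻ z, (1 + ‖z‖ₑ) ^ (-((k - 1) * p)) *
          (‖x - y‖ₑ ^ (-((n : ℝ) - 1)) * ‖y - z‖ₑ ^ (-k)) := by
        refine lintegral_congr fun y => ?_
        rw [enorm_bdry_sub, rieszPotential, ← lintegral_mul_const _ (by fun_prop)]
        refine lintegral_congr fun z => ?_
        rw [← ENNReal.rpow_mul, neg_mul, neg_sub]
        ring
    _ = ∫⁻ z, ∫⁻ y, (1 + ‖z‖ₑ) ^ (-((k - 1) * p)) *
          (‖x - y‖ₑ ^ (-((n : ℝ) - 1)) * ‖y - z‖ₑ ^ (-k)) :=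
        lintegral_lintegral_swap (by fun_prop)
    _ ≤ ∫⁻ z, C₁ * ((1 + ‖z‖ₑ) ^ (-((k - 1) * p)) * ‖x - z‖ₑ ^ (-(k - 1))) := by
        refine lintegral_mono fun z => ?_
        rw [lintegral_const_mul _ (by fun_prop), mul_left_comm]
        refine mul_le_mul_right ((h1 x z).trans (le_of_eq ?_)) _
        congr 2; ring
    _ ≤ C₁ * C₂ * (1 + ‖x‖ₑ) ^ (-(k - 1)) := by
        rw [lintegral_const_mul _ (by fun_prop), mul_assoc]
        exact mul_le_mul_right (h2 x) _

theorem exists_rieszPotential_le {k p : ℝ} (hk1 : 1 < k) (hkn : k < n) (hp0 : 0 < p)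
    (hp : n < (k - 1) * p) {g : Eucl n → ℝ≥0∞} {A : ℝ≥0∞} (hA : A < ∞)
    (hg : ∀ y, g y ≤ A * (1 + ‖y‖ₑ) ^ (-(k - 1))) :
    ∃ D : ℝ≥0∞, D < ∞ ∧
      ∀ y, rieszPotential k (fun z => g z ^ p) y ≤ D * (1 + ‖y‖ₑ) ^ (-k) := by
  obtain ⟨C, hC, h⟩ := exists_lintegral_weight_mul_enorm_rpow_le_weight (d := n)
    (s := (k - 1) * p) (b := k) hp (by linarith) hkn
  have hAp : A ^ p < ∞ := ENNReal.rpow_lt_top_of_nonneg hp0.le hA.ne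
  refine ⟨A ^ p * C, by finiteness, fun y => ?_⟩
  calc rieszPotential k (fun z => g z ^ p) y
      ≤ ∫⁻ z, A ^ p * ((1 + ‖z‖ₑ) ^ (-((k - 1) * p)) * ‖y - z‖ₑ ^ (-k)) := by
        refine lintegral_mono fun z => ?_
        rw [← mul_assoc]
        refine mul_le_mul_left ((ENNReal.rpow_le_rpow (hg z) hp0.le).trans (le_of_eq ?_)) _
        rw [ENNReal.mul_rpow_of_nonneg _ _ hp0.le, ← ENNReal.rpow_mul, neg_mul]
    _ ≤ A ^ p * C * (1 + ‖y‖ₑ) ^ (-k) := by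
        rw [lintegral_const_mul _ (by fun_prop), mul_assoc]
        exact mul_le_mul_right (h y) _

/-- Monotone iteration below a supersolution for the integral equation on the boundary. -/
theorem exists_bdry_fixedPoint {k p : ℝ} (hp : 0 < p) {c A : ℝ≥0∞}
    {G w : Eucl n → ℝ≥0∞} (hG : Measurable G) (hw : Measurable w) (hGw : ∀ y, G y ≤ A * w y)
    (hsuper : ∀ y, c * ((2 * A) ^ p * compositePotential k p w (bdry y)) ≤ A * w y) :
    ∃ g : Eucl n → ℝ≥0∞, Measurable g ∧ (∀ y, g y ≤ 2 * A * w y) ∧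
      ∀ y, g y = G y + c * compositePotential k p g (bdry y) := by
  have hb := measurable_bdry (n := n)
  let T : (Eucl n → ℝ≥0∞) → Eucl n → ℝ≥0∞ := fun g y =>
    G y + c * compositePotential k p g (bdry y)
  have hT : Monotone T := fun g₁ g₂ h y =>
    add_le_add_right (mul_le_mul_right (compositePotential_mono hp.le h _) _) _
  let g : ℕ → Eucl n → ℝ≥0∞ := fun j => T^[j] 0
  have hsucc : ∀ j, g (j + 1) = T (g j) := fun j => Function.iterate_succ_apply' T j 0
  have hmono : Monotone g := monotone_nat_of_le_succ fun j => by
    induction j with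
    | zero => intro y; exact zero_le
    | succ j ih => rw [hsucc, hsucc (j + 1)]; exact hT ih
  have hmeas : ∀ j, Measurable (g j) := fun j => by
    induction j with
    | zero => exact measurable_const
    | succ j ih =>
      rw [hsucc]
      have := measurable_compositePotential (k := k) (p := p) ih
      exact hG.add ((this.comp hb).const_mul c)
  -- The barrier 2Aw is preserved by `T`: the source uses one copy of Aw and the nonlinear term the
  -- other.
  have hbound : ∀ j, g j ≤ fun y => 2 * A * w y := fun j => by
    induction j with
    | zero => intro y; exact zero_le
    | succ j ih =>
      rw [hsucc]
      intro y
      calc T (g j) y ≤ T (fun y => 2 * A * w y) y := hT ih y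
        _ = G y + c * ((2 * A) ^ p * compositePotential k p w (bdry y)) := by
          simp only [T]
          rw [compositePotential_const_mul hp.le _ hw]
        _ ≤ A * w y + A * w y := add_le_add (hGw y) (hsuper y)
        _ = 2 * A * w y := by ring
  refine ⟨fun y => ⨆ j, g j y, .iSup hmeas, fun y => iSup_le fun j => hbound j y, fun y => ?_⟩
  rw [iSup_compositePotential hp hmeas hmono, ENNReal.mul_iSup, ENNReal.add_iSup]
  have : ⨆ j, g j y = ⨆ j, g (j + 1) y :=
    (Monotone.iSup_nat_add (f := fun j => g j y) (fun i j hij => hmono hij y) 1).symm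
  simp only [this, hsucc, T]

/-- Define u everywhere by the right-hand side of the integral equation with g as boundary density.
The fixed-point identity says that u restricts to g on the boundary, so the equation for u holds at
every point. -/
theorem exists_isPositiveSolution_of_fixedPoint (hn : 2 ≤ n) {k p lam : ℝ} (hk1 : 1 < k)
    (hkn : k < n) (hp0 : 0 < p) (hp : n < (k - 1) * p) {μ : Measure (Eucl (n + 1))} [SFinite μ]
    (hμ : μ ≠ 0) (hsupp : μ.support ⊆ upper n) (hfin : ∀ x, newtonPotential μ x < ∞)
    {g : Eucl n → ℝ≥0∞} {A : ℝ≥0∞} (hA : A < ∞) (hgm : Measurable g)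
    (hg : ∀ y, g y ≤ A * (1 + ‖y‖ₑ) ^ (-(k - 1)))
    (hfix : ∀ y, g y = greenPotential μ (bdry y) +
      ENNReal.ofReal (2 * lam / (((n : ℝ) - 1) * sphereArea n)) *
        compositePotential k p g (bdry y)) :
    ∃ u : Eucl (n + 1) → ℝ, IsPositiveSolution k p lam μ u ∧
      ∃ γ : ℝ≥0, 0 < γ ∧ γ < 1 ∧
        MemHolderSpace γ (closedUpper n) (fun x => u x - (greenPotential μ x).toReal) := by
  set c := ENNReal.ofReal (2 * lam / (((n : ℝ) - 1) * sphereArea n))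
  have hct : c < ∞ := ENNReal.ofReal_lt_top
  obtain ⟨D, hD, hr⟩ := exists_rieszPotential_le hk1 hkn hp0 hp hA hg
  -- The density decays with exponent k > 1, so any Hölder exponent in (0,1) would do; 1/2 is
  -- chosen.
  obtain ⟨M, K, hM, hK, hLM, hLK⟩ := exists_layerPotential_bound_holder hn
    (measurable_rieszPotential (k := k) (hgm.pow_const p)) (γ := ((1 / 2 : ℝ≥0) : ℝ)) hk1
    (by norm_num) (by norm_num) hD hr
  change ∀ x, compositePotential k p g x ≤ M at hLM
  change ∀ x z, compositePotential k p g x ≤ compositePotential k p g z + _ at hLK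
  have hLt : ∀ x, c * compositePotential k p g x ≠ ∞ := fun x =>
    ENNReal.mul_ne_top hct.ne ((hLM x).trans_lt hM).ne
  have hholder : ∀ S, MemHolderSpace (1 / 2) S
      fun x => (c * compositePotential k p g x).toReal :=
    memHolderSpace_toReal (ENNReal.mul_lt_top hct hM) (ENNReal.mul_lt_top hct hK)
      (fun x => mul_le_mul_right (hLM x) _) fun x z => by
        rw [mul_assoc, ← mul_add]
        exact mul_le_mul_right (hLK x z) _
  have hGt : ∀ x, greenPotential μ x ≠ ∞ := fun x => by
    rw [greenPotential_eq hsupp]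
    exact (ENNReal.add_lt_top.2 ⟨hfin _, hfin _⟩).ne
  have hGm : Measurable (greenPotential μ) := by
    rw [show greenPotential μ = fun x => newtonPotential μ x + newtonPotential μ (reflect x) from
      funext fun x => greenPotential_eq hsupp x]
    exact (measurable_newtonPotential μ).add
      ((measurable_newtonPotential μ).comp continuous_reflect.measurable)
  have hgt : ∀ y, g y ≠ ∞ := fun y => by
    rw [hfix y]
    exact ENNReal.add_ne_top.2 ⟨hGt _, hLt _⟩
  set u : Eucl (n + 1) → ℝ := fun x => (greenPotential μ x + c * compositePotential k p g x).toReal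
    with hu_def
  have hub : ∀ y, ENNReal.ofReal (u (bdry y)) = g y := fun y => by
    rw [hu_def]
    simp only
    rw [← hfix y, ENNReal.ofReal_toReal (hgt y)]
  have hadd : ∀ x, u x = (greenPotential μ x).toReal +
      (c * compositePotential k p g x).toReal := fun x => ENNReal.toReal_add (hGt x) (hLt x)
  have hum : Measurable u :=
    (hGm.add ((measurable_compositePotential hgm).const_mul c)).ennreal_toReal
  have hnl : nonlocalTerm k p u = rieszPotential k fun z => g z ^ p := by
    funext y
    simp only [nonlocalTerm, rieszPotential, hub]
  have hlift : liftedTerm k p u = compositePotential k p g := by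
    funext x
    simp only [liftedTerm, hnl, compositePotential, layerPotential]
  refine ⟨u, ⟨hum.aemeasurable, (hum.comp measurable_bdry).aemeasurable, ?_, ?_, ?_, ?_, ?_⟩, 1 / 2,
    by norm_num, NNReal.half_lt_self one_ne_zero, ?_⟩
  · refine Eventually.of_forall fun x => ?_
    obtain ⟨a, ha, h⟩ := exists_le_newtonPotential hn hμ (R := ‖x‖ + 1) (by positivity)
    refine ENNReal.toReal_pos ?_ (ENNReal.add_ne_top.2 ⟨hGt _, hLt _⟩)
    refine ((pos_iff_ne_zero.2 ha).trans_le ?_).ne'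
    rw [greenPotential_eq hsupp]
    exact (h x (by linarith)).trans (le_self_add.trans le_self_add)
  · refine Eventually.of_forall fun x' => Tendsto.mono_left ?_ nhdsWithin_le_nhds
    rw [show u = fun x => (greenPotential μ x).toReal + (c * compositePotential k p g x).toReal from
      funext hadd]
    refine Tendsto.add ((ENNReal.tendsto_toReal (hGt _)).comp
      (tendsto_greenPotential_bdry hn hsupp hfin x')) ?_
    obtain ⟨K', hK'⟩ := (hholder univ).2
    exact (continuousOn_univ.1 (hK'.continuousOn (by norm_num))).tendsto _
  · refine Eventually.of_forall fun y => ?_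
    rw [hnl]
    have h1 : (1 + ‖y‖ₑ) ^ (-k) ≤ 1 := by
      simpa using ENNReal.rpow_neg_le_rpow_neg (a := k) (by linarith)
        (le_self_add : (1 : ℝ≥0∞) ≤ 1 + ‖y‖ₑ)
    exact (hr y).trans_lt (ENNReal.mul_lt_top hD (h1.trans_lt ENNReal.one_lt_top))
  · refine Eventually.of_forall fun x => ?_
    rw [hlift]
    exact (hLM x).trans_lt hM
  · refine Eventually.of_forall fun x => ?_
    rw [hlift, hu_def]
    exact ENNReal.ofReal_toReal (ENNReal.add_ne_top.2 ⟨hGt _, hLt _⟩)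
  · convert hholder (closedUpper n) using 2 with x
    rw [hadd, add_sub_cancel_left]

theorem exists_pos_forall_lt_exists_isPositiveSolution (hn : 2 ≤ n) {k p : ℝ} (hk1 : 1 < k)
    (hkn : k < n) (hp0 : 0 < p) (hp : n / (k - 1) < p) {μ : Measure (Eucl (n + 1))} [SFinite μ]
    (hμ : μ ≠ 0) (hsupp : μ.support ⊆ upper n) (hfin : ∀ x, newtonPotential μ x < ∞)
    {C : ℝ} (hC : 0 < C)
    (hU : ∀ᵐ x, newtonPotential μ x ≤ ENNReal.ofReal (C * (1 + ‖x‖) ^ (1 - k))) :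
    ∃ lamStar : ℝ, 0 < lamStar ∧ ∀ lam : ℝ, 0 < lam → lam < lamStar →
      ∃ u : Eucl (n + 1) → ℝ, IsPositiveSolution k p lam μ u ∧
        ∃ γ : ℝ≥0, 0 < γ ∧ γ < 1 ∧
          MemHolderSpace γ (closedUpper n) (fun x => u x - (greenPotential μ x).toReal) := by
  have hn' : (2 : ℝ) ≤ n := by exact_mod_cast hn
  have hp' : n < (k - 1) * p := by
    rw [div_lt_iff₀ (by linarith)] at hp
    linarith
  have hcont : Continuous fun x : Eucl (n + 1) => ENNReal.ofReal (C * (1 + ‖x‖) ^ (1 - k)) :=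
    ENNReal.continuous_ofReal.comp (continuous_const.mul
      ((continuous_const.add continuous_norm).rpow_const fun x => Or.inl
        (add_pos_of_pos_of_nonneg one_pos (norm_nonneg x)).ne'))
  have hU' := newtonPotential_le_of_ae hcont hU
  -- On the boundary reflection is trivial, so the Green potential is twice the Newtonian one.
  set A : ℝ≥0∞ := 2 * ENNReal.ofReal C
  have hA0 : A ≠ 0 := mul_ne_zero two_ne_zero (by simpa using hC)
  have hAt : A ≠ ∞ := by finiteness
  have hGw : ∀ y : Eucl n, greenPotential μ (bdry y) ≤ A * (1 + ‖y‖ₑ) ^ (-(k - 1)) := by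
    intro y
    rw [greenPotential_eq hsupp, reflect_bdry, ← two_mul, mul_assoc]
    refine mul_le_mul_right ((hU' (bdry y)).trans (le_of_eq ?_)) _
    rw [norm_bdry, ENNReal.ofReal_mul hC.le, ← ENNReal.ofReal_rpow_of_pos (by positivity),
      ENNReal.ofReal_add zero_le_one (norm_nonneg _), ofReal_norm, ENNReal.ofReal_one, neg_sub]
  obtain ⟨B, hB, hBw⟩ := exists_compositePotential_weight_le hn hk1 hkn hp'
  set X := (2 * A) ^ p * B
  have hX : X ≠ ∞ :=
    ENNReal.mul_ne_top (ENNReal.rpow_ne_top_of_nonneg hp0.le (by finiteness)) hB.ne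
  have hq : A / (X + 1) ≠ ∞ := ENNReal.div_ne_top hAt (by simp)
  have hε : 0 < (A / (X + 1)).toReal :=
    ENNReal.toReal_pos (ENNReal.div_ne_zero.2 ⟨hA0, by finiteness⟩) hq
  have hσ : 0 < ((n : ℝ) - 1) * sphereArea n := mul_pos (by linarith) sphereArea_pos
  -- This threshold is the condition c ≤ A/(X+1), which implies the supersolution inequality c X ≤
  -- A; the added 1 avoids division by zero.
  refine ⟨(A / (X + 1)).toReal * (((n : ℝ) - 1) * sphereArea n) / 2, by positivity,
    fun lam _ hlam => ?_⟩
  set c := ENNReal.ofReal (2 * lam / (((n : ℝ) - 1) * sphereArea n))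
  have hc : c * X ≤ A := by
    have h1 : c ≤ A / (X + 1) := by
      rw [← ENNReal.ofReal_toReal hq]
      refine ENNReal.ofReal_le_ofReal ?_
      rw [div_le_iff₀ hσ]
      linarith
    calc c * X ≤ A / (X + 1) * (X + 1) := mul_le_mul' h1 le_self_add
      _ = A := ENNReal.div_mul_cancel (by simp) (by finiteness)
  have hGm : Measurable fun y : Eucl n => greenPotential μ (bdry y) := by
    simp only [greenPotential_eq hsupp, reflect_bdry]
    exact ((measurable_newtonPotential μ).comp measurable_bdry).add
      ((measurable_newtonPotential μ).comp measurable_bdry)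
  obtain ⟨g, hgm, hg, hfix⟩ := exists_bdry_fixedPoint hp0 (k := k) (c := c) hGm
    (w := fun y => (1 + ‖y‖ₑ) ^ (-(k - 1))) (by fun_prop) hGw fun y => by
      calc c * ((2 * A) ^ p * compositePotential k p _ (bdry y))
          ≤ c * ((2 * A) ^ p * (B * (1 + ‖y‖ₑ) ^ (-(k - 1)))) := by
            gcongr
            exact hBw y
        _ = c * X * (1 + ‖y‖ₑ) ^ (-(k - 1)) := by simp only [X]; ring
        _ ≤ A * (1 + ‖y‖ₑ) ^ (-(k - 1)) := by gcongr
  exact exists_isPositiveSolution_of_fixedPoint hn hk1 hkn hp0 hp' hμ hsupp hfin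
    (A := 2 * A) (by finiteness) hgm hg hfix

end HalfSpace

theorem theorem1p1 (n : ℕ) (hn : 2 ≤ n) (k p : ℝ) (hk0 : 0 < k) (hkn : k < n) (hp : 0 < p)
    (μ : Measure (Eucl (n + 1))) [IsFiniteMeasureOnCompacts μ]
    (hsupp : μ.support ⊆ upper n)
    (hfin : ∀ x, newtonPotential μ x < ∞)
    (hμ : μ ≠ 0) :
    ((k ≤ 1 ∨ (1 < k ∧ p < n / (k - 1))) →
      ∀ lam : ℝ, 0 < lam → ¬ ∃ u : Eucl (n + 1) → ℝ, IsPositiveSolution k p lam μ u) ∧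
    ((1 < k ∧ p = n / (k - 1)) →
      ∀ lam : ℝ, 0 < lam → ¬ ∃ u : Eucl (n + 1) → ℝ, IsPositiveSolution k p lam μ u ∧
        MemLp (fun x' : Eucl n => u (bdry x')) (ENNReal.ofReal p) volume) ∧
    ((1 < k ∧ n / (k - 1) < p ∧
        ∃ C : ℝ, 0 < C ∧ ∀ᵐ x : Eucl (n + 1),
          newtonPotential μ x ≤ ENNReal.ofReal (C * (1 + ‖x‖) ^ (1 - k))) →
      ∃ lamStar : ℝ, 0 < lamStar ∧ ∀ lam : ℝ, 0 < lam → lam < lamStar →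
        ∃ u : Eucl (n + 1) → ℝ, IsPositiveSolution k p lam μ u ∧
          ∃ γ : ℝ≥0, 0 < γ ∧ γ < 1 ∧
            MemHolderSpace γ (closedUpper n) (fun x => u x - (greenPotential μ x).toReal)) := by
  refine ⟨fun hcase lam hlam ⟨u, hu⟩ => ?_, fun ⟨hk1, hpk⟩ lam hlam ⟨u, hu, hL⟩ => ?_,
    fun ⟨hk1, hpk, C, hC, hU⟩ => ?_⟩
  · rcases hcase with hk1 | ⟨hk1, hpk⟩
    · exact not_isPositiveSolution_of_le_one hn hk0 hk1 hp hμ hsupp hu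
    · exact not_isPositiveSolution_of_lt hn hk1 hkn hp hpk hlam hμ hsupp hu
  · exact not_isPositiveSolution_of_eq hn hk1 hp hpk hlam hμ hsupp hL hu
  · exact exists_pos_forall_lt_exists_isPositiveSolution hn hk1 hkn hp hpk hμ hsupp hfin hC hU
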